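/- **Conventions.** $k$ is the security parameter. Probabilistic polynomial time (PPT) is meant in the non-uniform sense: families of Boolean circuits of size polynomial in $k$ that read additional uniform coins. All algorithms below are PPT. A function of $k$ is negligible if it decays faster than every inverse polynomial. For every $k$ fix a modulus $q\ge 2$ (integers in $(-q/2,q/2)$ are represented by residues in $[0,q)$, negative ones in the upper half; for $q=2^b$ the sign is the $b$-th bit) and sizes $n,d$. For $v\in\mathbb Z_q$ with representative in $[0,q)$ let $\mathrm{sgn}(v)=1$ if $2v\ge q$ and $0$ otherwise. For data $Z\in\mathbb Z_q^{n\times d}$ (rows $x_iy_i$) and a classifier $w\in\mathbb Z_q^d$, the indicator vector is $I\in\{0,1\}^n$ with $I_i=1-\mathrm{sgn}((Zw)_i)$. **Primitives.** * A generator $\mathcal G$ maps seeds to $\mathbb Z_q^n$. It is *pseudo-random* if no PPT distinguisher tells $\mathcal G(\text{seed})$ from a uniform element of $\mathbb Z_q^n$ with non-negligible advantage. * An HE scheme with plaintexts $\mathbb Z_q$ has algorithms for key generation, encryption $E$, decryption, a homomorphic dot product of $d$ ciphertexts with a plain vector, and a homomorphic addition. Decryption is correct on fresh encryptions and on $E(z)\cdot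 w+E(m)$, for $z,w\in\mathbb Z_q^d$ and $m\in\mathbb Z_q$. The homomorphic identity $E(z)\cdot w+E(m)=E(z\cdot w+m)$ holds between random ciphertexts in the following sense: no PPT algorithm that knows the coins of the key generation (hence both keys) and chooses $z,w,m$ tells the two sides apart with non-negligible advantage. The scheme is *CPA-secure* if no PPT adversary that gets the public key and chooses two plaintexts tells their encryptions apart with non-negligible advantage. * Let $C$ be circuits computing, from the bits of $u,\lambda\in\mathbb Z_q^n$, the $n$ bits $\mathrm{sgn}(u_i-\lambda_i)$. A garbling GC of $C$ produces a garbled circuit and two labels (one for each truth value) for each input wire and each output wire, the two labels of an output wire being different. From the garbled circuit and the labels of any input of $C$, evaluation gives the labels of the output bits of $C$ on this input. It is *CPA-secure* if no PPT adversary that chooses two inputs of $C$ tells the pairs (garbled circuit, input labels) belonging to them apart with non-negligible advantage. **Protocol (HE+GC construction of SecureBoost, one iteration).** (1) CSP generates an HE key pair and publishes the public key. (2) The users, holding $Z$, send $E(Z)$ (entrywise) to Cloud, which holds $w$. (3) Cloud computes $\lambda=\mathcal G(\text{seed})$ for a random seed and sends $E(Z)w+E(\lambda)$ to CSP, which decrypts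 it to $u$. (4) CSP garbles $C$ and sends the garbled circuit and the labels of the bits of $u$; Cloud gets the labels of the bits of $\lambda$ by an ideal oblivious transfer. (5) Cloud evaluates and sends the output labels to CSP, which decodes them and outputs the resulting indicator vector. Channels are secure, users are honest, and at most one of Cloud and CSP is corrupted. **Security.** The adversary is honest-but-curious: it sees the inputs, coins and received messages of the corrupted party as they become available, and exchanges messages with a PPT environment, but has no influence on the parties. The environment activates the adversary polynomially often, decides when the execution goes to the next of the steps (1)–(5), chooses the inputs $Z,w$ when step (2) starts, sees the output of CSP, and finally outputs a bit. In the ideal process the functionality $\mathcal F$ receives $Z$ from the users and $w$ from Cloud and gives $I$ to CSP; a simulator in place of the adversary sees only the number of the current step and the corrupted party's part of this ($w$ for Cloud, or $I$ for CSP). The protocol *UC-realizes* $\mathcal F$ for a given corrupted party if for every PPT adversary $\mathcal A$ there is a PPT simulator $\mathcal S$ such that for every PPT environment $\mathcal Z$ and all auxiliary inputs $m_{\mathcal Z}$ of $\mathcal Z$ and $m_{\mathcal A/\mathcal S}$ of $\mathcal A$ and $\mathcal S$, $$\bigl|\Pr[\mathrm{Real}_{\mathcal A,\mathcal Z}(k)=1]-\Pr[\mathrm{Ideal}_{\mathcal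 F,\mathcal S,\mathcal Z}(k)=1]\bigr|$$ is negligible in $k$. **Theorem 1.** If $\mathcal G$ is pseudo-random and both the HE scheme and GC are CPA-secure, then the HE+GC construction of SecureBoost UC-realizes $\mathcal F$ against honest-but-curious adversaries, both when Cloud is the corrupted party and when CSP is. -/

import Mathlib

namespace SecureBoost

/-! ### Boolean circuits, and probabilistic polynomial time -/

/-- A gate reading wires from `ι`. NAND together with the constants is a complete basis. -/
inductive Gate (ι : Type) : Type
  | const (b : Bool) : Gate ι
  | nand (i j : ι) : Gate ι

/-- The value of a gate, given the values of the wires. -/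
def Gate.eval {ι : Type} (x : ι → Bool) : Gate ι → Bool
  | .const b => b
  | .nand i j => !(x i && x j)

/-- Boolean circuits (straight-line programs) with input wires `ι` and output wires `κ`:
either stop, and connect every output to an available wire, or add one gate, whose value is the
new wire `none`, and go on with one more wire. -/
inductive Circuit (κ : Type) : Type → Type 1
  | output {ι : Type} (o : κ → ι) : Circuit κ ι
  | gate {ι : Type} (g : Gate ι) (c : Circuit κ (Option ι)) : Circuit κ ι

/-- The Boolean function computed by a circuit. -/
def Circuit.eval {κ : Type} : {ι : Type} → Circuit κ ι → (ι → Bool) → κ → Bool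
  | _, .output o, x => fun j => x (o j)
  | _, .gate g c, x => c.eval (fun w => w.elim (g.eval x) x)

/-- The number of gates of a circuit. -/
def Circuit.gates {κ : Type} : {ι : Type} → Circuit κ ι → ℕ
  | _, .output _ => 0
  | _, .gate _ c => c.gates + 1

/-- An injective encoding of a type by bit strings of a fixed length;
the positions of the string are indexed by a finite type. -/
class BitRep (α : Type) where
  /-- the positions of the bit string -/
  Idx : Type
  /-- there are finitely many positions -/
  [fintypeIdx : Fintype Idx]
  /-- the encoding -/
  enc : α → Idx → Bool
  /-- the encoding is injective -/
  enc_injective : Function.Injective enc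

attribute [reducible, instance] BitRep.fintypeIdx

/-- Bit strings of length `m`. -/
abbrev Bits (m : ℕ) : Type := Fin m → Bool

instance : BitRep Bool where
  Idx := Unit
  enc b _ := b
  enc_injective _ _ h := congrFun h ()

/-- Elements of a `Fin` are encoded in one-hot form. -/
instance (m : ℕ) : BitRep (Fin m) where
  Idx := Fin m
  enc a i := decide (i = a)
  enc_injective a b h := by
    have := congrFun h a
    simpa using this

instance (ι α : Type) [Fintype ι] [BitRep α] : BitRep (ι → α) where
  Idx := ι × BitRep.Idx α
  enc f p := BitRep.enc (f p.1) p.2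
  enc_injective f g h := by
    funext i
    apply BitRep.enc_injective
    funext j
    exact congrFun h (i, j)

instance (α β : Type) [BitRep α] [BitRep β] : BitRep (α × β) where
  Idx := BitRep.Idx α ⊕ BitRep.Idx β
  enc p := Sum.elim (BitRep.enc p.1) (BitRep.enc p.2)
  enc_injective p r h := by
    apply Prod.ext
    · apply BitRep.enc_injective
      funext i
      exact congrFun h (Sum.inl i)
    · apply BitRep.enc_injective
      funext i
      exact congrFun h (Sum.inr i)

/-- `Option α` is encoded by a flag followed by the encoding of the value (or by zeros). -/
instance (α : Type) [BitRep α] : BitRep (Option α) where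
  Idx := Option (BitRep.Idx α)
  enc o := fun i => match o, i with
    | none, _ => false
    | some _, none => true
    | some a, some j => BitRep.enc a j
  enc_injective o r h := by
    cases o with
    | none =>
      cases r with
      | none => rfl
      | some b => exact absurd (congrFun h none) (by simp)
    | some a =>
      cases r with
      | none => exact absurd (congrFun h none) (by simp)
      | some b =>
        congr 1
        apply BitRep.enc_injective
        funext j
        exact congrFun h (some j)

/-- The number of bits needed to represent the values in `[0, q)`. -/
abbrev bitLen (q : ℕ) : ℕ := Nat.clog 2 q

/-- The binary representation of a residue modulo `q` (of its representative in `[0, q)`). -/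
def zmodBits {q : ℕ} (v : ZMod q) (i : Fin (bitLen q)) : Bool := v.val.testBit i

instance (q : ℕ) [NeZero q] : BitRep (ZMod q) where
  Idx := Fin (bitLen q)
  enc v := zmodBits v
  enc_injective v w h := by
    apply ZMod.val_injective q
    apply Nat.eq_of_testBit_eq
    intro i
    have hq : q ≤ 2 ^ bitLen q := Nat.le_pow_clog (by norm_num) q
    by_cases hi : i < bitLen q
    · exact congrFun h ⟨i, hi⟩
    · have hp : 2 ^ bitLen q ≤ 2 ^ i := Nat.pow_le_pow_right (by norm_num) (not_lt.mp hi)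
      rw [Nat.testBit_lt_two_pow (lt_of_lt_of_le (ZMod.val_lt v) (hq.trans hp)),
        Nat.testBit_lt_two_pow (lt_of_lt_of_le (ZMod.val_lt w) (hq.trans hp))]

/-- A family of functions, indexed by the security parameter, is efficient if it is computed by
circuits of polynomial size; the input and the output wires are counted as well.
Randomized algorithms are functions with an additional argument `Bits _` for their coins, so that
an efficient randomized algorithm is a (non-uniform) probabilistic polynomial-time algorithm. -/
def Eff {α β : ℕ → Type} [∀ k, BitRep (α k)] [∀ k, BitRep (β k)]
    (f : ∀ k, α k → β k) : Prop :=
  ∃ p : Polynomial ℕ, ∀ k, ∃ c : Circuit (BitRep.Idx (β k)) (BitRep.Idx (α k)),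
    c.gates + Fintype.card (BitRep.Idx (α k)) + Fintype.card (BitRep.Idx (β k)) ≤ p.eval k ∧
    ∀ a, c.eval (BitRep.enc a) = BitRep.enc (f k a)

/-- The probability of the event `E` for a uniformly random element of the finite type `Ω`. -/
noncomputable def Pr {Ω : Type} [Fintype Ω] (E : Ω → Bool) : ℝ :=
  ((Finset.univ.filter fun ω => E ω = true).card : ℝ) / Fintype.card Ω

/-- Negligible functions of the security parameter. -/
def Negligible (f : ℕ → ℝ) : Prop :=
  Asymptotics.SuperpolynomialDecay Filter.atTop (fun k : ℕ => (k : ℝ)) f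

/-! ### Parameters and ideal function -/

/-- For every security parameter: the plaintext modulus `q`, the number `n` of training records,
and their dimension `d`. -/
structure Params where
  q : ℕ → ℕ
  n : ℕ → ℕ
  d : ℕ → ℕ
  two_le_q : ∀ k, 2 ≤ q k

instance (P : Params) (k : ℕ) : NeZero (P.q k) := ⟨by have := P.two_le_q k; omega⟩

namespace Params
variable (P : Params) (k : ℕ)

/-- Plaintexts: integers modulo `q`. -/
abbrev R : Type := ZMod (P.q k)

/-- Parameters `w` of a linear classifier. -/
abbrev Classifier : Type := Fin (P.d k) → P.R k

/-- Vectors with one residue for every record, such as `Z w` and the noise. -/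
abbrev Vec : Type := Fin (P.n k) → P.R k

/-- Training data: row `i` of `Z` is the feature vector of record `i` times its label. -/
abbrev Data : Type := Fin (P.n k) → Fin (P.d k) → P.R k

/-- Indicator vectors. -/
abbrev Indicator : Type := Fin (P.n k) → Bool

/-- The input of one execution: the data `Z` of the users, and the classifier `w` of Cloud. -/
abbrev Input : Type := P.Data k × P.Classifier k

/-- The input wires of the circuit for sign checking: first the bits of the noisy vector
(CSP's input), then those of the noise (Cloud's input). -/
abbrev Wire : Type :=
  (Fin (P.n k) × Fin (bitLen (P.q k))) ⊕ (Fin (P.n k) × Fin (bitLen (P.q k)))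

end Params

/-- The sign bit of a residue. Integers in `(-q/2, q/2)` are represented modulo `q`, so that
the upper half of `[0, q)` holds the negative numbers; for `q = 2 ^ b` this is the top bit. -/
def signBit {q : ℕ} (v : ZMod q) : Bool := decide (q ≤ 2 * v.val)

/-- The indicator vector `I`: entry `i` tells if `(Z w)ᵢ` is not negative. -/
def indicator (P : Params) (k : ℕ) (x : P.Input k) : P.Indicator k :=
  fun i => !signBit (∑ j, x.1 i j * x.2 j)

/-- The values on the input wires of the circuit for sign checking. -/
def wireBits (P : Params) (k : ℕ) (u v : P.Vec k) : P.Wire k → Bool :=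
  Sum.elim (fun p => zmodBits (u p.1) p.2) (fun p => zmodBits (v p.1) p.2)

/-- The circuits `C` remove the noise and extract the sign bit of every entry. -/
def ComputesSigns (P : Params) (C : ∀ k, Circuit (Fin (P.n k)) (P.Wire k)) : Prop :=
  ∀ k (u v : P.Vec k) (i : Fin (P.n k)),
    (C k).eval (wireBits P k u v) i = signBit (u i - v i)

/-! ### Generators of random numbers -/

/-- An efficient generator that expands a seed to a noise vector. -/
structure Generator (P : Params) where
  seedLen : ℕ → ℕ
  gen : ∀ k, Bits (seedLen k) → P.Vec k
  gen_eff : Eff gen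

/-- No efficient distinguisher tells the output of the generator from a uniform vector. -/
def Generator.PseudoRandom {P : Params} (G : Generator P) : Prop :=
  ∀ (r : ℕ → ℕ) (D : ∀ k, Bits (r k) × P.Vec k → Bool), Eff D →
    Negligible fun k =>
      |Pr (fun ω : Bits (r k) × Bits (G.seedLen k) => D k (ω.1, G.gen k ω.2)) -
        Pr (fun ω : Bits (r k) × P.Vec k => D k ω)|

/-! ### Homomorphic encryption -/

/-- A public-key encryption scheme for residues modulo `q`, with a homomorphic dot product of
encrypted and plain vectors, and a homomorphic addition. -/
structure HEScheme (P : Params) where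
  pkLen : ℕ → ℕ
  skLen : ℕ → ℕ
  ctLen : ℕ → ℕ
  keyCoins : ℕ → ℕ
  encCoins : ℕ → ℕ
  keygen : ∀ k, Bits (keyCoins k) → Bits (pkLen k) × Bits (skLen k)
  enc : ∀ k, Bits (pkLen k) × P.R k × Bits (encCoins k) → Bits (ctLen k)
  dec : ∀ k, Bits (skLen k) × Bits (ctLen k) → P.R k
  dot : ∀ k, Bits (pkLen k) × (Fin (P.d k) → Bits (ctLen k)) × P.Classifier k → Bits (ctLen k)
  add : ∀ k, Bits (pkLen k) × Bits (ctLen k) × Bits (ctLen k) → Bits (ctLen k)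
  keygen_eff : Eff keygen
  enc_eff : Eff enc
  dec_eff : Eff dec
  dot_eff : Eff dot
  add_eff : Eff add
  /-- Decryption inverts encryption. -/
  dec_enc : ∀ k (κ : Bits (keyCoins k)) (m : P.R k) (ρ : Bits (encCoins k)),
    dec k ((keygen k κ).2, enc k ((keygen k κ).1, m, ρ)) = m
  /-- A dot product followed by an addition is evaluated correctly. -/
  dec_add_dot : ∀ k (κ : Bits (keyCoins k)) (z w : P.Classifier k) (m : P.R k)
    (σ : Fin (P.d k) → Bits (encCoins k)) (ρ : Bits (encCoins k)),
    dec k ((keygen k κ).2, add k ((keygen k κ).1,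
      dot k ((keygen k κ).1, (fun j => enc k ((keygen k κ).1, z j, σ j)), w),
      enc k ((keygen k κ).1, m, ρ))) = (∑ j, z j * w j) + m

namespace HEScheme
variable {P : Params} (HE : HEScheme P)

/-- Security against chosen-plaintext attacks: an efficient adversary, given the public key,
chooses two plaintexts, and cannot tell which of them has been encrypted. -/
def CPASecure : Prop :=
  ∀ (r : ℕ → ℕ) (choose : ∀ k, Bits (r k) × Bits (HE.pkLen k) → P.R k × P.R k)
    (guess : ∀ k, Bits (r k) × Bits (HE.pkLen k) × Bits (HE.ctLen k) → Bool),
    Eff choose → Eff guess →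
    Negligible fun k =>
      |Pr (fun ω : Bits (r k) × Bits (HE.keyCoins k) × Bits (HE.encCoins k) =>
          let pk := (HE.keygen k ω.2.1).1
          guess k (ω.1, pk, HE.enc k (pk, (choose k (ω.1, pk)).1, ω.2.2))) -
        Pr (fun ω : Bits (r k) × Bits (HE.keyCoins k) × Bits (HE.encCoins k) =>
          let pk := (HE.keygen k ω.2.1).1
          guess k (ω.1, pk, HE.enc k (pk, (choose k (ω.1, pk)).2, ω.2.2)))|

/-- The homomorphic identity `E(z ⬝ w) + E(m) = E(z ⬝ w + m)` between random ciphertexts: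
for plaintexts `z`, `w`, `m` of its choice, no efficient algorithm that holds the keys (and the
coins of the key generation) tells the homomorphically computed ciphertext on the left from the
fresh encryption on the right. -/
def Homomorphic : Prop :=
  ∀ (r : ℕ → ℕ)
    (choose : ∀ k, Bits (r k) × Bits (HE.keyCoins k) →
      P.Classifier k × P.Classifier k × P.R k)
    (guess : ∀ k, Bits (r k) × Bits (HE.keyCoins k) × Bits (HE.ctLen k) → Bool),
    Eff choose → Eff guess →
    Negligible fun k =>
      |Pr (fun ω : Bits (r k) × Bits (HE.keyCoins k) ×
            (Fin (P.d k) → Bits (HE.encCoins k)) × Bits (HE.encCoins k) =>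
          let pk := (HE.keygen k ω.2.1).1
          let x := choose k (ω.1, ω.2.1)
          guess k (ω.1, ω.2.1, HE.add k (pk,
            HE.dot k (pk, (fun j => HE.enc k (pk, x.1 j, ω.2.2.1 j)), x.2.1),
            HE.enc k (pk, x.2.2, ω.2.2.2)))) -
        Pr (fun ω : Bits (r k) × Bits (HE.keyCoins k) × Bits (HE.encCoins k) =>
          let pk := (HE.keygen k ω.2.1).1
          let x := choose k (ω.1, ω.2.1)
          guess k (ω.1, ω.2.1,
            HE.enc k (pk, (∑ j, x.1 j * x.2.1 j) + x.2.2, ω.2.2)))|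

end HEScheme

/-! ### Garbled circuits -/

/-- A garbling of the circuits `C`. The garbler produces the garbled circuit and two labels, one
for each truth value, for every input wire and every output wire. From the garbled circuit and one
label per input wire the evaluator finds the labels of the output values. -/
structure GarbledCircuit {ι κ : ℕ → Type} [∀ k, Fintype (ι k)] [∀ k, Fintype (κ k)]
    (C : ∀ k, Circuit (κ k) (ι k)) where
  gcLen : ℕ → ℕ
  labelLen : ℕ → ℕ
  coins : ℕ → ℕ
  garble : ∀ k, Bits (coins k) → Bits (gcLen k) ×
    (ι k → Bool → Bits (labelLen k)) × (κ k → Bool → Bits (labelLen k))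
  evaluate : ∀ k, Bits (gcLen k) × (ι k → Bits (labelLen k)) → κ k → Bits (labelLen k)
  garble_eff : Eff garble
  evaluate_eff : Eff evaluate
  correct : ∀ k (ρ : Bits (coins k)) (x : ι k → Bool),
    evaluate k ((garble k ρ).1, fun i => (garble k ρ).2.1 i (x i)) =
      fun j => (garble k ρ).2.2 j ((C k).eval x j)
  /-- The two labels of an output wire are different. -/
  label_ne : ∀ k (ρ : Bits (coins k)) (j : κ k),
    (garble k ρ).2.2 j false ≠ (garble k ρ).2.2 j true

/-- Security against chosen-plaintext attacks: an efficient adversary chooses two inputs of the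
circuit, and cannot tell which of them is encoded by the input labels that it receives together
with the garbled circuit. -/
def GarbledCircuit.CPASecure {ι κ : ℕ → Type} [∀ k, Fintype (ι k)] [∀ k, Fintype (κ k)]
    {C : ∀ k, Circuit (κ k) (ι k)} (GC : GarbledCircuit C) : Prop :=
  ∀ (r : ℕ → ℕ) (choose : ∀ k, Bits (r k) → (ι k → Bool) × (ι k → Bool))
    (guess : ∀ k, Bits (r k) × Bits (GC.gcLen k) × (ι k → Bits (GC.labelLen k)) → Bool),
    Eff choose → Eff guess →
    Negligible fun k =>
      |Pr (fun ω : Bits (r k) × Bits (GC.coins k) =>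
          let g := GC.garble k ω.2
          guess k (ω.1, g.1, fun i => g.2.1 i ((choose k ω.1).1 i))) -
        Pr (fun ω : Bits (r k) × Bits (GC.coins k) =>
          let g := GC.garble k ω.2
          guess k (ω.1, g.1, fun i => g.2.1 i ((choose k ω.1).2 i)))|

/-! ### Executions with an environment

An execution passes through the phases
`0` nothing has happened,
`1` CSP has generated the keys and published the public key,
`2` users and Cloud have got their inputs, and Cloud has received the encrypted data,
`3` Cloud has sent the noisy ciphertexts to CSP,
`4` CSP has sent the garbled circuit and its labels, and Cloud has got the labels of its own
input by oblivious transfer,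
`5` Cloud has sent the output labels to CSP, and CSP has output the indicator vector. -/

/-- What an execution shows to the outside, as a function of the phase and of the input:
to the adversary, and as the output of CSP to the environment. -/
structure World (P : Params) (V : Type) (k : ℕ) where
  view : Fin 6 → P.Input k → V
  out : Fin 6 → P.Input k → Option (P.Indicator k)

/-- A probabilistic polynomial-time adversary. It starts from an auxiliary input and coins. In
each activation it reads what the corrupted party has seen so far, and a message of the
environment, and answers to the environment. It is honest-but-curious: it has no influence on
the parties. -/
structure Adversary (V : ℕ → Type) [∀ k, BitRep (V k)] (aux envMsg advMsg : ℕ → ℕ) where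
  coins : ℕ → ℕ
  stateLen : ℕ → ℕ
  init : ∀ k, Bits (aux k) × Bits (coins k) → Bits (stateLen k)
  step : ∀ k, Bits (stateLen k) × V k × Bits (envMsg k) →
    Bits (stateLen k) × Bits (advMsg k)
  init_eff : Eff init
  step_eff : Eff step

/-- A probabilistic polynomial-time environment. In each activation it reads the last answer of
the adversary and the output of CSP (if there is one), and decides if the execution proceeds to
the next phase, and with which input if that is phase `2`, and what to tell the adversary. After
a polynomial number of activations of its choice it outputs a bit. -/
structure Environment (P : Params) (aux envMsg advMsg : ℕ → ℕ) where
  coins : ℕ → ℕ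
  stateLen : ℕ → ℕ
  rounds : ℕ → ℕ
  init : ∀ k, Bits (aux k) × Bits (coins k) → Bits (stateLen k)
  step : ∀ k, Bits (stateLen k) × Bits (advMsg k) × Option (P.Indicator k) →
    Bits (stateLen k) × Bool × P.Input k × Bits (envMsg k)
  verdict : ∀ k, Bits (stateLen k) → Bool
  init_eff : Eff init
  step_eff : Eff step
  verdict_eff : Eff verdict
  rounds_le : ∃ p : Polynomial ℕ, ∀ k, rounds k ≤ p.eval k

/-- The configuration of an execution between two activations of the environment. -/
structure Config (P : Params) (envLen advLen msgLen k : ℕ) where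
  env : Bits envLen
  adv : Bits advLen
  phase : Fin 6
  input : P.Input k
  reply : Bits msgLen

/-- The next phase. -/
def nextPhase (p : Fin 6) : Fin 6 := ⟨min (p.val + 1) 5, by omega⟩

section
variable {P : Params} {V : ℕ → Type} [∀ k, BitRep (V k)] {auxE auxA envMsg advMsg : ℕ → ℕ}

/-- One activation of the environment, followed by one of the adversary. -/
def round (E : Environment P auxE envMsg advMsg) (A : Adversary V auxA envMsg advMsg) (k : ℕ)
    (W : World P (V k) k) (c : Config P (E.stateLen k) (A.stateLen k) (advMsg k) k) :
    Config P (E.stateLen k) (A.stateLen k) (advMsg k) k :=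
  let e := E.step k (c.env, c.reply, W.out c.phase c.input)
  let phase := if e.2.1 then nextPhase c.phase else c.phase
  let input := if e.2.1 && decide (c.phase = 1) then e.2.2.1 else c.input
  let a := A.step k (c.adv, W.view phase input, e.2.2.2)
  ⟨e.1, a.1, phase, input, a.2⟩

/-- The bit that the environment outputs at the end of an execution, for given auxiliary inputs
`mE`, `mA` and coins `ρE`, `ρA` of environment and adversary. -/
def exec (E : Environment P auxE envMsg advMsg) (A : Adversary V auxA envMsg advMsg) (k : ℕ)
    (W : World P (V k) k) (mE : Bits (auxE k)) (mA : Bits (auxA k))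
    (ρE : Bits (E.coins k)) (ρA : Bits (A.coins k)) : Bool :=
  E.verdict k ((round E A k W)^[E.rounds k]
    ⟨E.init k (mE, ρE), A.init k (mA, ρA), 0, 0, fun _ => false⟩).env

end

/-- The real protocol `real` (which depends on the coins of the parties) UC-realizes the ideal
process `ideal`: for every adversary there is a simulator such that no environment, for no
auxiliary inputs, tells the two executions apart. -/
def UCRealizes (P : Params) {VR VI Ω : ℕ → Type} [∀ k, BitRep (VR k)] [∀ k, BitRep (VI k)]
    [∀ k, Fintype (Ω k)] (real : ∀ k, Ω k → World P (VR k) k)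
    (ideal : ∀ k, World P (VI k) k) : Prop :=
  ∀ (auxA envMsg advMsg : ℕ → ℕ) (A : Adversary VR auxA envMsg advMsg),
    ∃ S : Adversary VI auxA envMsg advMsg,
      ∀ (auxE : ℕ → ℕ) (E : Environment P auxE envMsg advMsg)
        (mE : ∀ k, Bits (auxE k)) (mA : ∀ k, Bits (auxA k)),
        Negligible fun k =>
          |Pr (fun ω : Bits (E.coins k) × Bits (A.coins k) × Ω k =>
              exec E A k (real k ω.2.2) (mE k) (mA k) ω.1 ω.2.1) -
            Pr (fun ω : Bits (E.coins k) × Bits (S.coins k) =>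
              exec E S k (ideal k) (mE k) (mA k) ω.1 ω.2)|

/-- Something that becomes available in phase `t`. -/
def fromPhase {α : Type} (t p : Fin 6) (a : α) : Option α := if t ≤ p then some a else none

/-! ### The protocol -/

section
variable {P : Params} (G : Generator P) (HE : HEScheme P)
  {C : ∀ k, Circuit (Fin (P.n k)) (P.Wire k)} (GC : GarbledCircuit C)

/-- The coins of all honest computations: of CSP for the keys, of the users for the encryption of
every entry of `Z`, of Cloud for the seed of the generator and the encryption of the noise, and
of CSP for the garbling. -/
structure Coins (k : ℕ) where
  key : Bits (HE.keyCoins k)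
  data : Fin (P.n k) → Fin (P.d k) → Bits (HE.encCoins k)
  seed : Bits (G.seedLen k)
  noise : Fin (P.n k) → Bits (HE.encCoins k)
  garbling : Bits (GC.coins k)

/-- The coins as a product of types of bit strings. -/
def Coins.equiv (k : ℕ) : Coins G HE GC k ≃
    Bits (HE.keyCoins k) × (Fin (P.n k) → Fin (P.d k) → Bits (HE.encCoins k)) ×
      Bits (G.seedLen k) × (Fin (P.n k) → Bits (HE.encCoins k)) × Bits (GC.coins k) where
  toFun ω := (ω.key, ω.data, ω.seed, ω.noise, ω.garbling)
  invFun x := ⟨x.1, x.2.1, x.2.2.1, x.2.2.2.1, x.2.2.2.2⟩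
  left_inv _ := rfl
  right_inv _ := rfl

instance (k : ℕ) : Fintype (Coins G HE GC k) := Fintype.ofEquiv _ (Coins.equiv G HE GC k).symm

namespace Coins
variable {G HE GC} {k : ℕ} (ω : Coins G HE GC k) (x : P.Input k)

/-- CSP: the public key. -/
def pk : Bits (HE.pkLen k) := (HE.keygen k ω.key).1

/-- CSP: the secret key. -/
def sk : Bits (HE.skLen k) := (HE.keygen k ω.key).2

/-- Users: the encrypted data `E(Z)`, sent to Cloud. -/
def encData : Fin (P.n k) → Fin (P.d k) → Bits (HE.ctLen k) :=
  fun i j => HE.enc k (ω.pk, x.1 i j, ω.data i j)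

/-- Cloud: the noise, made by the generator. -/
def noiseVec : P.Vec k := G.gen k ω.seed

/-- Cloud: the encrypted predictions `E(Z w)`. -/
def encPred : Fin (P.n k) → Bits (HE.ctLen k) :=
  fun i => HE.dot k (ω.pk, ω.encData x i, x.2)

/-- Cloud: the noisy ciphertexts `E(Z w) + E(noise)`, sent to CSP. -/
def encNoisy : Fin (P.n k) → Bits (HE.ctLen k) :=
  fun i => HE.add k (ω.pk, ω.encPred x i, HE.enc k (ω.pk, ω.noiseVec i, ω.noise i))

/-- CSP: the decrypted noisy vector. -/
def noisy : P.Vec k := fun i => HE.dec k (ω.sk, ω.encNoisy x i)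

/-- CSP: the garbled circuit, sent to Cloud. -/
def garbled : Bits (GC.gcLen k) := (GC.garble k ω.garbling).1

/-- The labels of the input wires that reach Cloud: CSP sends those of its own input, the noisy
vector, and those of the noise come from an ideal oblivious transfer. -/
def inputLabels : P.Wire k → Bits (GC.labelLen k) :=
  fun i => (GC.garble k ω.garbling).2.1 i (wireBits P k (ω.noisy x) ω.noiseVec i)

/-- Cloud: the labels of the output wires, sent to CSP. -/
def outputLabels : Fin (P.n k) → Bits (GC.labelLen k) :=
  GC.evaluate k (ω.garbled, ω.inputLabels x)

/-- CSP: the output, decoded from the labels; the sign bit of a correct prediction is `0`. -/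
def output : P.Indicator k :=
  fun i => !decide (ω.outputLabels x i = (GC.garble k ω.garbling).2.2 i true)

end Coins

/-- All that Cloud gets: the public key; its input and the encrypted data; its coins; the garbled
circuit and the input labels. This determines everything that it computes, sends and outputs. -/
abbrev CloudView (k : ℕ) : Type :=
  Option (Bits (HE.pkLen k)) ×
  Option (P.Classifier k × (Fin (P.n k) → Fin (P.d k) → Bits (HE.ctLen k))) ×
  Option (Bits (G.seedLen k) × (Fin (P.n k) → Bits (HE.encCoins k))) ×
  Option (Bits (GC.gcLen k) × (P.Wire k → Bits (GC.labelLen k)))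

/-- All that CSP gets: its coins for the keys; the noisy ciphertexts; its coins for the garbling;
the output labels. This determines everything that it computes, sends and outputs. -/
abbrev CSPView (k : ℕ) : Type :=
  Option (Bits (HE.keyCoins k)) ×
  Option (Fin (P.n k) → Bits (HE.ctLen k)) ×
  Option (Bits (GC.coins k)) ×
  Option (Fin (P.n k) → Bits (GC.labelLen k))

/-- The real protocol with an adversary that has corrupted Cloud. -/
def realCloud (k : ℕ) (ω : Coins G HE GC k) : World P (CloudView G HE GC k) k where
  view p x := (fromPhase 1 p ω.pk, fromPhase 2 p (x.2, ω.encData x),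
    fromPhase 3 p (ω.seed, ω.noise), fromPhase 4 p (ω.garbled, ω.inputLabels x))
  out p x := fromPhase 5 p (ω.output x)

/-- The real protocol with an adversary that has corrupted CSP. -/
def realCSP (k : ℕ) (ω : Coins G HE GC k) : World P (CSPView HE GC k) k where
  view p x := (fromPhase 1 p ω.key, fromPhase 3 p (ω.encNoisy x),
    fromPhase 4 p ω.garbling, fromPhase 5 p (ω.outputLabels x))
  out p x := fromPhase 5 p (ω.output x)

end

/-! ### The ideal process

The ideal functionality takes `Z` from the users and `w` from Cloud, and gives the indicator
vector to CSP, and nothing else to anyone. The simulator sees the phase, and the input and the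
output of the corrupted party. -/

/-- The ideal process with a simulator that has corrupted Cloud. -/
def idealCloud (P : Params) (k : ℕ) : World P (Fin 6 × Option (P.Classifier k)) k where
  view p x := (p, fromPhase 2 p x.2)
  out p x := fromPhase 5 p (indicator P k x)

/-- The ideal process with a simulator that has corrupted CSP. -/
def idealCSP (P : Params) (k : ℕ) : World P (Fin 6 × Option (P.Indicator k)) k where
  view p x := (p, fromPhase 5 p (indicator P k x))
  out p x := fromPhase 5 p (indicator P k x)

end SecureBoost

/-!
The real executions are compared with those of a simulator by sequences of hybrid executions. In
both cases the simulator runs the given adversary on views that it makes up, and CSP's output is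
exactly the indicator vector by correctness, so that only the views have to be compared.

*Corrupted Cloud* (`realCloud_realizes`). The made-up views hold encryptions of zeros and the
labels of an all-zero input of the circuit. Security of the garbling lets one replace the labels
of the true input by those of zeros; after this neither the secret key nor the data are used
except for encryption, and CPA security, applied entry by entry, lets one replace the data by zeros.

*Corrupted CSP* (`realCSP_realizes`). The made-up views hold encryptions of `G(seed)`. In the real
view the ciphertexts `E(Z) w + E(G(seed))` are replaced by fresh encryptions of `Z w + G(seed)`
(homomorphic identity, entry by entry), `G(seed)` by a uniform vector, `Z w` plus uniform by
uniform, and uniform by `G(seed)` again. The output labels are determined by CSP's own coins and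
the indicator vector.

The games are not interactive while an execution is, and in the games the messages are chosen in
advance. The link is `exec_eq_ofTables`: the environment fixes the input when phase `2` starts,
knowing only what is visible in phase `1`. So the input is an efficient function of the coins and
of the key material that the reductions know, and then the verdict is an efficient function of
the values in the view.

The rest is the theory of the class `Eff`. Reductions run whole executions, so they need closure
under composition, pairing, vectors and iteration. They also need circuits for arithmetic modulo
`q` and for sign checking; these are obtained from the encryption scheme and the garbling
themselves, run with fixed keys and coins. For games with many challenges, the nonuniform model
allows the reduction to use for each security parameter the worst of the polynomially many
hybrid steps (`Close.of_chain`, `Indist.pi`).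
-/

namespace SecureBoost

/-! ### Combining Boolean circuits -/

section Circuits
variable {ι ι' κ μ : Type}

/-- Renaming the wires that a gate reads. -/
def Gate.map (f : ι → ι') : Gate ι → Gate ι'
  | .const b => .const b
  | .nand i j => .nand (f i) (f j)

theorem Gate.eval_map (f : ι → ι') (g : Gate ι) (x : ι' → Bool) :
    (g.map f).eval x = g.eval (fun i => x (f i)) := by
  cases g <;> rfl

/-- Renaming the input wires of a circuit. -/
def Circuit.rename {κ : Type} : {ι ι' : Type} → (ι → ι') → Circuit κ ι → Circuit κ ι'
  | _, _, f, .output o => .output (fun j => f (o j))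
  | _, _, f, .gate g c => .gate (g.map f) (c.rename (Option.map f))

theorem Circuit.eval_rename {ι : Type} (c : Circuit κ ι) :
    ∀ {ι' : Type} (f : ι → ι') (x : ι' → Bool),
      (c.rename f).eval x = c.eval (fun i => x (f i)) := by
  induction c with
  | output o => intros; rfl
  | gate g c ih =>
    intro ι' f x
    simp only [Circuit.rename, Circuit.eval, ih, Gate.eval_map]
    congr 1
    funext w
    cases w <;> rfl

theorem Circuit.gates_rename {ι : Type} (c : Circuit κ ι) :
    ∀ {ι' : Type} (f : ι → ι'), (c.rename f).gates = c.gates := by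
  induction c with
  | output o => intros; rfl
  | gate g c ih => intro ι' f; simp [Circuit.rename, Circuit.gates, ih]

/-- Running a second circuit on the input wires and the output wires of a first one. -/
def Circuit.bind {κ μ : Type} : {ι : Type} → Circuit κ ι → Circuit μ (ι ⊕ κ) → Circuit μ ι
  | _, .output o, c' => c'.rename (Sum.elim id o)
  | _, .gate g c, c' => .gate g (c.bind (c'.rename (Sum.map some id)))

theorem Circuit.eval_bind {ι : Type} (c : Circuit κ ι) :
    ∀ (c' : Circuit μ (ι ⊕ κ)) (x : ι → Bool),
      (c.bind c').eval x = c'.eval (Sum.elim x (c.eval x)) := by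
  induction c with
  | output o =>
    intro c' x
    simp only [Circuit.bind, Circuit.eval_rename]
    congr 1
    funext w
    cases w <;> rfl
  | gate g c ih =>
    intro c' x
    simp only [Circuit.bind, Circuit.eval, ih, Circuit.eval_rename]
    congr 1
    funext w
    cases w <;> rfl

theorem Circuit.gates_bind {ι : Type} (c : Circuit κ ι) :
    ∀ c' : Circuit μ (ι ⊕ κ), (c.bind c').gates = c.gates + c'.gates := by
  induction c with
  | output o => intro c'; simp [Circuit.bind, Circuit.gates, Circuit.gates_rename]
  | gate g c ih =>
    intro c'
    simp only [Circuit.bind, Circuit.gates, ih, Circuit.gates_rename]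
    omega

/-- A function on bit strings is computed by a circuit with at most `s` gates. -/
def HasCircuit (s : ℕ) (f : (ι → Bool) → κ → Bool) : Prop :=
  ∃ c : Circuit κ ι, c.gates ≤ s ∧ ∀ x, c.eval x = f x

/-- A single bit is computed by a circuit with at most `s` gates. -/
def HasBit (s : ℕ) (b : (ι → Bool) → Bool) : Prop :=
  HasCircuit s fun x (_ : Unit) => b x

theorem HasCircuit.mono {s t : ℕ} {f : (ι → Bool) → κ → Bool} (h : HasCircuit s f)
    (hst : s ≤ t) : HasCircuit t f :=
  let ⟨c, hc, he⟩ := h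
  ⟨c, hc.trans hst, he⟩

theorem hasCircuit_wire (o : κ → ι) : HasCircuit 0 fun (x : ι → Bool) j => x (o j) :=
  ⟨.output o, le_rfl, fun _ => rfl⟩

theorem HasCircuit.bind {s t : ℕ} {f : (ι → Bool) → κ → Bool} {g : (ι ⊕ κ → Bool) → μ → Bool}
    (hf : HasCircuit s f) (hg : HasCircuit t g) :
    HasCircuit (s + t) fun x => g (Sum.elim x (f x)) := by
  obtain ⟨c, hc, he⟩ := hf
  obtain ⟨c', hc', he'⟩ := hg
  exact ⟨c.bind c', by rw [Circuit.gates_bind]; omega,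
    fun x => by rw [Circuit.eval_bind, he', he]⟩

theorem HasCircuit.rename {s : ℕ} {f : (ι → Bool) → κ → Bool} (hf : HasCircuit s f)
    (o : ι → ι') : HasCircuit s fun (x : ι' → Bool) => f fun i => x (o i) := by
  obtain ⟨c, hc, he⟩ := hf
  exact ⟨c.rename o, by rwa [Circuit.gates_rename], fun x => by rw [Circuit.eval_rename, he]⟩

theorem HasCircuit.comp {s t : ℕ} {f : (ι → Bool) → κ → Bool} {g : (κ → Bool) → μ → Bool}
    (hg : HasCircuit t g) (hf : HasCircuit s f) : HasCircuit (s + t) fun x => g (f x) :=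
  hf.bind (hg.rename Sum.inr)

theorem HasCircuit.reindex {s : ℕ} {f : (ι → Bool) → κ → Bool} (hf : HasCircuit s f)
    (o : μ → κ) : HasCircuit s fun x j => f x (o j) := by
  simpa using (hasCircuit_wire o).comp hf

theorem HasCircuit.bit {s : ℕ} {f : (ι → Bool) → κ → Bool} (hf : HasCircuit s f) (j : κ) :
    HasBit s fun x => f x j :=
  hf.reindex fun _ => j

theorem HasCircuit.sum {s t : ℕ} {f : (ι → Bool) → κ → Bool} {g : (ι → Bool) → μ → Bool}
    (hf : HasCircuit s f) (hg : HasCircuit t g) :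
    HasCircuit (s + t) fun x => Sum.elim (f x) (g x) := by
  have h := hf.bind ((hg.rename (Sum.inl : ι → ι ⊕ κ)).bind
    (hasCircuit_wire (Sum.elim (fun j => Sum.inl (Sum.inr j)) Sum.inr)))
  refine (h.mono (by omega)).imp fun c hc => ⟨hc.1, fun x => (hc.2 x).trans ?_⟩
  funext j
  cases j <;> rfl

theorem HasBit.comp {s t : ℕ} {b : (κ → Bool) → Bool} {f : (ι → Bool) → κ → Bool}
    (hb : HasBit t b) (hf : HasCircuit s f) : HasBit (s + t) fun x => b (f x) :=
  HasCircuit.comp hb hf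

theorem HasBit.mono {s t : ℕ} {b : (ι → Bool) → Bool} (h : HasBit s b) (hst : s ≤ t) :
    HasBit t b :=
  HasCircuit.mono h hst

theorem hasBit_wire (i : ι) : HasBit 0 fun x => x i := hasCircuit_wire fun _ => i

theorem hasBit_const (b : Bool) : HasBit 1 fun _ : ι → Bool => b :=
  ⟨.gate (.const b) (.output fun _ => none), le_rfl, fun _ => rfl⟩

theorem HasBit.nand {s t : ℕ} {a b : (ι → Bool) → Bool} (ha : HasBit s a) (hb : HasBit t b) :
    HasBit (s + t + 1) fun x => !(a x && b x) := by
  have hg : HasBit 1 fun y : Unit ⊕ Unit → Bool => !(y (.inl ()) && y (.inr ())) :=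
    ⟨.gate (.nand (.inl ()) (.inr ())) (.output fun _ => none), le_rfl, fun _ => rfl⟩
  exact hg.comp (HasCircuit.sum ha hb)

theorem HasBit.not {s : ℕ} {a : (ι → Bool) → Bool} (ha : HasBit s a) :
    HasBit (s + 2) fun x => !(a x) := by
  simpa using ha.nand (hasBit_const true)

theorem HasBit.and {s t : ℕ} {a b : (ι → Bool) → Bool} (ha : HasBit s a) (hb : HasBit t b) :
    HasBit (s + t + 3) fun x => a x && b x := by
  simpa using (ha.nand hb).not

theorem HasBit.or {s t : ℕ} {a b : (ι → Bool) → Bool} (ha : HasBit s a) (hb : HasBit t b) :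
    HasBit (s + t + 5) fun x => a x || b x := by
  simpa using (ha.not.nand hb.not).mono (t := s + t + 5) (by omega)

theorem HasBit.of_eq {s t : ℕ} {a b : (ι → Bool) → Bool} (ha : HasBit s a) (hst : s ≤ t)
    (h : ∀ x, a x = b x) : HasBit t b := by
  obtain rfl : a = b := funext h
  exact ha.mono hst

theorem HasBit.cond {s t u : ℕ} {c a b : (ι → Bool) → Bool} (hc : HasBit s c) (ha : HasBit t a)
    (hb : HasBit u b) : HasBit (2 * s + t + u + 13) fun x => bif c x then a x else b x :=
  ((hc.and ha).or (hc.not.and hb)).of_eq (by omega) fun x => by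
    generalize c x = p, a x = q, b x = r
    revert p q r
    decide

theorem HasBit.beq {s t : ℕ} {a b : (ι → Bool) → Bool} (ha : HasBit s a) (hb : HasBit t b) :
    HasBit (2 * s + 2 * t + 15) fun x => a x == b x :=
  (ha.cond hb hb.not).of_eq (by omega) fun x => by
    generalize a x = p, b x = q
    revert p q
    decide

theorem hasCircuit_fin {s m : ℕ} {b : Fin m → (ι → Bool) → Bool} (h : ∀ j, HasBit s (b j)) :
    HasCircuit (m * s) fun x j => b j x := by
  induction m with
  | zero => exact ⟨.output Fin.elim0, by simp [Circuit.gates], fun x => funext fun j => j.elim0⟩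
  | succ m ih =>
    have h' := ((h 0).sum (ih fun j => h j.succ)).reindex
      (Fin.cases (Sum.inl ()) Sum.inr : Fin (m + 1) → Unit ⊕ Fin m)
    refine (h'.mono (t := (m + 1) * s) (by rw [Nat.succ_mul]; omega)).imp
      fun c hc => ⟨hc.1, fun x => (hc.2 x).trans (funext fun j => ?_)⟩
    cases j using Fin.cases <;> rfl

theorem hasCircuit_of_bits [Fintype κ] {s : ℕ} {b : κ → (ι → Bool) → Bool}
    (h : ∀ j, HasBit s (b j)) : HasCircuit (Fintype.card κ * s) fun x j => b j x := by
  simpa using (hasCircuit_fin fun j => h ((Fintype.equivFin κ).symm j)).reindex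
    (Fintype.equivFin κ)

theorem hasBit_forall_fin (m : ℕ) :
    HasBit (1 + 3 * m) fun x : Fin m → Bool => decide (∀ j, x j = true) := by
  induction m with
  | zero => exact (hasBit_const true).of_eq (by omega) fun x => by simp
  | succ m ih =>
    refine ((hasBit_wire 0).and (ih.comp (hasCircuit_wire Fin.succ))).of_eq (by omega)
      fun x => ?_
    rw [Bool.eq_iff_iff]
    simp [Fin.forall_fin_succ]

theorem hasBit_forall [Fintype κ] {s : ℕ} {b : κ → (ι → Bool) → Bool}
    (h : ∀ j, HasBit s (b j)) :
    HasBit (Fintype.card κ * (s + 3) + 1) fun x => decide (∀ j, b j x = true) :=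
  ((hasBit_forall_fin _).comp (hasCircuit_fin fun j => h ((Fintype.equivFin κ).symm j))).of_eq
    (le_of_eq (by ring)) fun x => by
      rw [Bool.eq_iff_iff, decide_eq_true_iff, decide_eq_true_iff]
      exact (Fintype.equivFin κ).symm.forall_congr_right (q := fun j => b j x = true)

theorem hasCircuit_iterate {s : ℕ} {f : (ι → Bool) → ι → Bool} (hf : HasCircuit s f) (m : ℕ) :
    HasCircuit (m * s) f^[m] := by
  induction m with
  | zero => exact (hasCircuit_wire id).mono (by simp)
  | succ m ih =>
    rw [Function.iterate_succ']
    exact (hf.comp ih).mono (le_of_eq (by ring))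

end Circuits

/-! ### Polynomial bounds and closure properties of efficient functions -/

/-- Bounded by a polynomial in the security parameter. -/
def PolyBdd (f : ℕ → ℕ) : Prop := ∃ p : Polynomial ℕ, ∀ k, f k ≤ p.eval k

namespace PolyBdd
variable {f g : ℕ → ℕ}

theorem mono (hg : PolyBdd g) (h : ∀ k, f k ≤ g k) : PolyBdd f :=
  hg.imp fun _ hp k => (h k).trans (hp k)

theorem const (m : ℕ) : PolyBdd fun _ => m := ⟨.C m, fun k => by simp⟩

theorem add (hf : PolyBdd f) (hg : PolyBdd g) : PolyBdd fun k => f k + g k :=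
  let ⟨p, hp⟩ := hf
  let ⟨r, hr⟩ := hg
  ⟨p + r, fun k => by simpa using add_le_add (hp k) (hr k)⟩

theorem mul (hf : PolyBdd f) (hg : PolyBdd g) : PolyBdd fun k => f k * g k :=
  let ⟨p, hp⟩ := hf
  let ⟨r, hr⟩ := hg
  ⟨p * r, fun k => by simpa using Nat.mul_le_mul (hp k) (hr k)⟩

end PolyBdd

/-- The encodings of the elements of a family of types have polynomial length. -/
def Small (α : ℕ → Type) [∀ k, BitRep (α k)] : Prop :=
  PolyBdd fun k => Fintype.card (BitRep.Idx (α k))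

namespace Small
variable {α β : ℕ → Type} [∀ k, BitRep (α k)] [∀ k, BitRep (β k)]

theorem prod (ha : Small α) (hb : Small β) : Small fun k => α k × β k :=
  (ha.add hb).mono fun k => (Fintype.card_sum (α := BitRep.Idx (α k)) (β := BitRep.Idx (β k))).le

theorem fst (h : Small fun k => α k × β k) : Small α :=
  h.mono fun k => (Nat.le_add_right _ _).trans
    (Fintype.card_sum (α := BitRep.Idx (α k)) (β := BitRep.Idx (β k))).ge

theorem snd (h : Small fun k => α k × β k) : Small β :=
  h.mono fun k => (Nat.le_add_left _ _).trans
    (Fintype.card_sum (α := BitRep.Idx (α k)) (β := BitRep.Idx (β k))).ge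

theorem option (h : Small α) : Small fun k => Option (α k) :=
  (h.add (.const 1)).mono fun k => (Fintype.card_option (α := BitRep.Idx (α k))).le

theorem pi {ι : ℕ → Type} [∀ k, Fintype (ι k)] (hι : PolyBdd fun k => Fintype.card (ι k))
    (h : Small α) : Small fun k => ι k → α k :=
  (hι.mul h).mono fun k => (Fintype.card_prod (ι k) (BitRep.Idx (α k))).le

theorem bits {m : ℕ → ℕ} (hm : PolyBdd m) : Small fun k => Bits (m k) :=
  (hm.mul (.const 1)).mono fun k =>
    ((Fintype.card_prod (Fin (m k)) Unit).trans (by simp)).le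

theorem bool : Small fun _ => Bool := .const 1

theorem fin (m : ℕ) : Small fun _ => Fin m := .const _

end Small

namespace Eff
variable {α β γ δ : ℕ → Type} [∀ k, BitRep (α k)] [∀ k, BitRep (β k)] [∀ k, BitRep (γ k)]
  [∀ k, BitRep (δ k)]

theorem small_dom {f : ∀ k, α k → β k} (hf : Eff f) : Small α := by
  obtain ⟨p, hp⟩ := hf
  exact ⟨p, fun k => by obtain ⟨c, hc, -⟩ := hp k; beta_reduce; omega⟩

theorem small_cod {f : ∀ k, α k → β k} (hf : Eff f) : Small β := by
  obtain ⟨p, hp⟩ := hf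
  exact ⟨p, fun k => by obtain ⟨c, hc, -⟩ := hp k; beta_reduce; omega⟩

theorem of_hasCircuit {f : ∀ k, α k → β k} (ha : Small α) (hb : Small β) {s : ℕ → ℕ}
    (hs : PolyBdd s) (F : ∀ k, (BitRep.Idx (α k) → Bool) → BitRep.Idx (β k) → Bool)
    (hF : ∀ k, HasCircuit (s k) (F k))
    (h : ∀ k a, F k (BitRep.enc a) = BitRep.enc (f k a)) : Eff f := by
  obtain ⟨p, hp⟩ := (hs.add ha).add hb
  refine ⟨p, fun k => ?_⟩
  obtain ⟨c, hc, he⟩ := hF k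
  exact ⟨c, (by have := hp k; beta_reduce at this; omega), fun a => (he _).trans (h k a)⟩

theorem exists_hasCircuit {f : ∀ k, α k → β k} (hf : Eff f) :
    ∃ s : ℕ → ℕ, PolyBdd s ∧
      ∃ F : ∀ k, (BitRep.Idx (α k) → Bool) → BitRep.Idx (β k) → Bool,
        (∀ k, HasCircuit (s k) (F k)) ∧ ∀ k a, F k (BitRep.enc a) = BitRep.enc (f k a) := by
  obtain ⟨p, hp⟩ := hf
  choose c hc he using hp
  exact ⟨fun k => p.eval k, ⟨p, fun _ => le_rfl⟩, fun k => (c k).eval,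
    fun k => ⟨c k, by have := hc k; beta_reduce; omega, fun _ => rfl⟩, he⟩

/-- A function is efficient if every single bit of its value is. -/
theorem of_hasBit {f : ∀ k, α k → β k} (ha : Small α) (hb : Small β) {s : ℕ → ℕ}
    (hs : PolyBdd s)
    (h : ∀ k j, ∃ b, HasBit (s k) b ∧ ∀ a, b (BitRep.enc a) = BitRep.enc (f k a) j) :
    Eff f := by
  choose b hb' he using h
  exact of_hasCircuit ha hb (hb.mul hs) (fun k x j => b k j x)
    (fun k => hasCircuit_of_bits (hb' k)) fun k a => funext fun j => he k j a

/-- A function is efficient if every bit of its value is a bit of its argument or a constant. -/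
theorem of_wiring {f : ∀ k, α k → β k} (ha : Small α) (hb : Small β)
    (w : ∀ k, BitRep.Idx (β k) → BitRep.Idx (α k) ⊕ Bool)
    (h : ∀ k a j, Sum.elim (BitRep.enc a) id (w k j) = BitRep.enc (f k a) j) : Eff f := by
  refine of_hasBit ha hb (.const 1) fun k j => ?_
  refine ⟨fun x => Sum.elim x id (w k j), ?_, fun a => h k a j⟩
  cases w k j with
  | inl i => exact (hasBit_wire i).mono (by omega)
  | inr b => exact hasBit_const b

theorem comp {g : ∀ k, β k → γ k} {f : ∀ k, α k → β k} (hg : Eff g) (hf : Eff f) :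
    Eff fun k a => g k (f k a) := by
  obtain ⟨s, hs, F, hF, hFe⟩ := hf.exists_hasCircuit
  obtain ⟨t, ht, H, hH, hHe⟩ := hg.exists_hasCircuit
  exact of_hasCircuit hf.small_dom hg.small_cod (hs.add ht) (fun k x => H k (F k x))
    (fun k => (hH k).comp (hF k)) fun k a => by rw [hFe, hHe]

theorem id (ha : Small α) : Eff fun k (a : α k) => a :=
  of_wiring ha ha (fun _ => Sum.inl) fun _ _ _ => rfl

theorem const (ha : Small α) (hb : Small β) (b : ∀ k, β k) : Eff fun k (_ : α k) => b k :=
  of_wiring ha hb (fun k j => .inr (BitRep.enc (b k) j)) fun _ _ _ => rfl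

theorem pair {f : ∀ k, α k → β k} {g : ∀ k, α k → γ k} (hf : Eff f) (hg : Eff g) :
    Eff fun k a => (f k a, g k a) := by
  obtain ⟨s, hs, F, hF, hFe⟩ := hf.exists_hasCircuit
  obtain ⟨t, ht, H, hH, hHe⟩ := hg.exists_hasCircuit
  exact of_hasCircuit hf.small_dom (hf.small_cod.prod hg.small_cod) (hs.add ht)
    (fun k x => Sum.elim (F k x) (H k x)) (fun k => (hF k).sum (hH k))
    fun k a => by rw [hFe, hHe]; rfl

theorem fst {f : ∀ k, α k → β k × γ k} (hf : Eff f) : Eff fun k a => (f k a).1 :=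
  (of_wiring (f := fun k (p : β k × γ k) => p.1) hf.small_cod hf.small_cod.fst
    (fun _ j => .inl (.inl j)) fun _ _ _ => rfl).comp hf

theorem snd {f : ∀ k, α k → β k × γ k} (hf : Eff f) : Eff fun k a => (f k a).2 :=
  (of_wiring (f := fun k (p : β k × γ k) => p.2) hf.small_cod hf.small_cod.snd
    (fun _ j => .inl (.inr j)) fun _ _ _ => rfl).comp hf

theorem cond {c : ∀ k, α k → Bool} {f g : ∀ k, α k → β k} (hc : Eff c) (hf : Eff f)
    (hg : Eff g) : Eff fun k a => bif c k a then f k a else g k a := by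
  refine (of_hasBit (f := fun k (p : Bool × β k × β k) => bif p.1 then p.2.1 else p.2.2)
    (hc.small_cod.prod (hf.small_cod.prod hf.small_cod)) hf.small_cod (.const 13)
    fun k j => ⟨_, (hasBit_wire (.inl ())).cond (hasBit_wire (.inr (.inl j)))
      (hasBit_wire (.inr (.inr j))), fun a => ?_⟩).comp (hc.pair (hf.pair hg))
  obtain ⟨c, a, b⟩ := a
  cases c <;> rfl

theorem iterate {f : ∀ k, α k → α k} (hf : Eff f) {m : ℕ → ℕ} (hm : PolyBdd m) :
    Eff fun k a => (f k)^[m k] a := by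
  obtain ⟨s, hs, F, hF, hFe⟩ := hf.exists_hasCircuit
  refine of_hasCircuit hf.small_dom hf.small_dom (hm.mul hs) (fun k => (F k)^[m k])
    (fun k => hasCircuit_iterate (hF k) (m k)) fun k a => ?_
  exact (Function.Semiconj.iterate_right (f := BitRep.enc) (fun a => (hFe k a).symm) (m k) a).symm

section Pi
variable {ι : ℕ → Type} [∀ k, Fintype (ι k)]

/-- An efficient function can be applied to all entries of a vector of polynomial length. -/
theorem map {f : ∀ k, β k → γ k} (hf : Eff f) (hι : PolyBdd fun k => Fintype.card (ι k))
    {g : ∀ k, α k → ι k → β k} (hg : Eff g) : Eff fun k a i => f k (g k a i) := by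
  obtain ⟨s, hs, F, hF, hFe⟩ := hf.exists_hasCircuit
  refine (of_hasBit (f := fun k (v : ι k → β k) i => f k (v i)) hg.small_cod
    (hf.small_cod.pi hι) hs fun k j => ⟨fun x => F k (fun i => x (j.1, i)) j.2,
      ((hF k).rename fun i => (j.1, i)).bit j.2, fun a => ?_⟩).comp hg
  exact congrFun (hFe k (a j.1)) j.2

theorem piPair {f : ∀ k, α k → ι k → β k} {g : ∀ k, α k → ι k → γ k} (hf : Eff f)
    (hg : Eff g) : Eff fun k a i => (f k a i, g k a i) := by
  refine (of_wiring (f := fun k (p : (ι k → β k) × (ι k → γ k)) i => (p.1 i, p.2 i))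
    (hf.small_cod.prod hg.small_cod)
    ((hf.small_cod.prod hg.small_cod).mono fun k => ?_)
    (fun k j => match j with
      | (i, .inl j) => .inl (.inl (i, j))
      | (i, .inr j) => .inl (.inr (i, j))) ?_).comp (hf.pair hg)
  · refine le_of_eq ?_
    exact Fintype.card_congr (Equiv.prodSumDistrib (ι k) (BitRep.Idx (β k)) (BitRep.Idx (γ k)))
  · rintro k a ⟨i, j | j⟩ <;> rfl

/-- Copying a value to all entries of a vector. -/
theorem piConst (hι : PolyBdd fun k => Fintype.card (ι k)) {f : ∀ k, α k → β k} (hf : Eff f) :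
    Eff fun k a (_ : ι k) => f k a :=
  (of_wiring (f := fun k (b : β k) (_ : ι k) => b) hf.small_cod (hf.small_cod.pi hι)
    (fun _ j => .inl j.2) fun _ _ _ => rfl).comp hf

end Pi

end Eff

/-! ### Further efficient functions -/

namespace Eff
variable {α β γ : ℕ → Type} [∀ k, BitRep (α k)] [∀ k, BitRep (β k)] [∀ k, BitRep (γ k)]

section Pi
variable {ι κ : ℕ → Type} [∀ k, Fintype (ι k)] [∀ k, Fintype (κ k)]

theorem piIte (c : ∀ k, ι k → Prop) [∀ k i, Decidable (c k i)] {f g : ∀ k, α k → ι k → β k}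
    (hf : Eff f) (hg : Eff g) : Eff fun k a i => if c k i then f k a i else g k a i := by
  refine (of_wiring (f := fun k (p : (ι k → β k) × (ι k → β k)) i =>
      if c k i then p.1 i else p.2 i) (hf.small_cod.prod hg.small_cod) hf.small_cod
    (fun k j => if c k j.1 then .inl (.inl j) else .inl (.inr j)) fun k a j => ?_).comp
    (hf.pair hg)
  change _ = BitRep.enc (if c k j.1 then a.1 j.1 else a.2 j.1) j.2
  split_ifs <;> rfl

/-- Reading a vector at a fixed place, if there is one. -/
theorem piElim (i : ∀ k, Option (ι k)) (b : ∀ k, β k) (hb : Small β)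
    {f : ∀ k, α k → ι k → β k} (hf : Eff f) : Eff fun k a => (i k).elim (b k) (f k a) := by
  refine (of_wiring (f := fun k (v : ι k → β k) => (i k).elim (b k) v) hf.small_cod hb
    (fun k j => (i k).elim (.inr (BitRep.enc (b k) j)) fun i => .inl (i, j))
    fun k a j => ?_).comp hf
  cases i k <;> rfl

theorem curry {f : ∀ k, α k → ι k × κ k → β k} (hf : Eff f) :
    Eff fun k a i j => f k a (i, j) := by
  refine (of_wiring (f := fun k (v : ι k × κ k → β k) i j => v (i, j)) hf.small_cod
    (hf.small_cod.mono fun k => le_of_eq ?_)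
    (fun k (j : ι k × κ k × BitRep.Idx (β k)) => .inl ((j.1, j.2.1), j.2.2))
    fun k a j => rfl).comp hf
  exact Fintype.card_congr (Equiv.prodAssoc (ι k) (κ k) (BitRep.Idx (β k))).symm

theorem uncurry {f : ∀ k, α k → ι k → κ k → β k} (hf : Eff f) :
    Eff fun k a (p : ι k × κ k) => f k a p.1 p.2 := by
  refine (of_wiring (f := fun k (v : ι k → κ k → β k) (p : ι k × κ k) => v p.1 p.2)
    hf.small_cod (hf.small_cod.mono fun k => le_of_eq ?_)
    (fun k (j : (ι k × κ k) × BitRep.Idx (β k)) => .inl (j.1.1, (j.1.2, j.2)))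
    fun k a j => rfl).comp hf
  exact Fintype.card_congr (Equiv.prodAssoc (ι k) (κ k) (BitRep.Idx (β k)))

theorem select {f : ∀ k, α k → ι k → Bool → β k} {g : ∀ k, α k → ι k → Bool} (hf : Eff f)
    (hg : Eff g) (hβ : Small fun k => ι k → β k) : Eff fun k a i => f k a i (g k a i) := by
  refine (of_hasBit (f := fun k (p : (ι k → Bool → β k) × (ι k → Bool)) i => p.1 i (p.2 i))
    (hf.small_cod.prod hg.small_cod) hβ (.const 13)
    fun k j => ⟨_, (hasBit_wire (.inr (j.1, ()))).cond (hasBit_wire (.inl (j.1, true, j.2)))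
      (hasBit_wire (.inl (j.1, false, j.2))), fun a => ?_⟩).comp (hf.pair hg)
  obtain ⟨a, c⟩ := a
  change (bif c j.1 then BitRep.enc (a j.1 true) j.2 else BitRep.enc (a j.1 false) j.2) =
    BitRep.enc (a j.1 (c j.1)) j.2
  cases c j.1 <;> rfl

theorem piDecideEq {f g : ∀ k, α k → ι k → β k} [∀ k, DecidableEq (β k)] (hf : Eff f)
    (hg : Eff g) (hι : PolyBdd fun k => Fintype.card (ι k)) :
    Eff fun k a i => decide (f k a i = g k a i) := by
  refine (of_hasBit (f := fun k (p : (ι k → β k) × (ι k → β k)) i => decide (p.1 i = p.2 i))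
    (hf.small_cod.prod hg.small_cod) (Small.bool.pi hι)
    ((hf.small_cod.mul (.const 18)).add (.const 1)) fun k j => ?_).comp (hf.pair hg)
  have h := hasBit_forall fun l : BitRep.Idx (β k) =>
    (hasBit_wire (ι := BitRep.Idx ((ι k → β k) × (ι k → β k))) (.inl (j.1, l))).beq
      (hasBit_wire (.inr (j.1, l)))
  refine ⟨_, h.mono ?_, fun a => ?_⟩
  · have h1 : 0 < Fintype.card (ι k) := Fintype.card_pos_iff.2 ⟨j.1⟩
    have h2 : Fintype.card (BitRep.Idx (ι k → β k)) =
      Fintype.card (ι k) * Fintype.card (BitRep.Idx (β k)) := Fintype.card_prod _ _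
    beta_reduce
    rw [h2]
    nlinarith [Nat.zero_le (Fintype.card (BitRep.Idx (β k)))]
  · change _ = decide (a.1 j.1 = a.2 j.1)
    rw [Bool.eq_iff_iff, decide_eq_true_iff, decide_eq_true_iff,
      ← BitRep.enc_injective.eq_iff, funext_iff]
    simp only [beq_iff_eq]
    rfl

end Pi

/-- Reading a table with a fixed number of entries. -/
theorem lookup {m : ℕ} {f : ∀ k, α k → Fin m → β k} {i : ∀ k, α k → Fin m} (hf : Eff f)
    (hi : Eff i) (hβ : Small β) : Eff fun k a => f k a (i k a) := by
  refine (of_hasBit (f := fun k (p : (Fin m → β k) × Fin m) => p.1 p.2)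
    (hf.small_cod.prod hi.small_cod) hβ (.const _)
    fun k j => ⟨_, (hasBit_forall fun l : Fin m => ((hasBit_wire (.inr l)).nand
      (hasBit_wire (.inl (l, j))))).not, fun a => ?_⟩).comp (hf.pair hi)
  obtain ⟨v, i⟩ := a
  rw [Bool.eq_iff_iff, Bool.not_eq_true', decide_eq_false_iff_not]
  change (¬∀ l, (!(decide (l = i) && BitRep.enc (v l) j)) = true) ↔ BitRep.enc (v i) j = true
  simp

theorem of_fin {m : ℕ} (hβ : Small β) (f : ∀ k, Fin m → β k) {i : ∀ k, α k → Fin m}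
    (hi : Eff i) : Eff fun k a => f k (i k a) :=
  lookup (f := fun k _ => f k) (const hi.small_dom (hβ.pi (.const _)) f) hi hβ

/-- The value of an option, where the default value is encoded by zeros. -/
theorem getD {f : ∀ k, α k → Option (β k)} (hf : Eff f) (hβ : Small β) (b : ∀ k, β k)
    (hb : ∀ k j, BitRep.enc (b k) j = false) : Eff fun k a => (f k a).getD (b k) := by
  refine (of_wiring (f := fun k (o : Option (β k)) => o.getD (b k)) hf.small_cod hβ
    (fun k j => .inl (some j)) fun k a j => ?_).comp hf
  cases a with
  | none => exact (hb k j).symm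
  | some a => rfl

/-- The table of what is available in each phase. -/
theorem fromPhase_table {f : ∀ k, α k → β k} (hf : Eff f) (t : Fin 6) :
    Eff fun k a (p : Fin 6) => fromPhase t p (f k a) := by
  refine (of_wiring (f := fun k (b : β k) (p : Fin 6) => fromPhase t p b) hf.small_cod
    (hf.small_cod.option.pi (.const _))
    (fun k j => match j with
      | (p, none) => .inr (decide (t ≤ p))
      | (p, some j) => if t ≤ p then .inl j else .inr false) fun k a j => ?_).comp hf
  obtain ⟨p, j⟩ := j
  change _ = BitRep.enc (fromPhase t p a) j
  by_cases h : t ≤ p <;> cases j <;>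
    simp only [fromPhase, h, decide_true, decide_false, if_true, if_false] <;> rfl

theorem fromPhase {f : ∀ k, α k → β k} (hf : Eff f) (t : Fin 6) {p : ∀ k, α k → Fin 6}
    (hp : Eff p) : Eff fun k a => fromPhase t (p k a) (f k a) :=
  lookup (hf.fromPhase_table t) hp hf.small_cod.option

end Eff

/-! ### Types of coins -/

/-- Every bit string is the encoding of some element, so that uniformly random elements
can be obtained from uniformly random bits. -/
class FullRep (α : Type) [BitRep α] : Prop where
  enc_surjective : Function.Surjective (BitRep.enc (α := α))

instance : FullRep Bool := ⟨fun x => ⟨x (), rfl⟩⟩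

instance (ι α : Type) [Fintype ι] [BitRep α] [FullRep α] : FullRep (ι → α) where
  enc_surjective x := by
    choose f hf using fun i => FullRep.enc_surjective (α := α) fun j => x (i, j)
    exact ⟨f, funext fun p => congrFun (hf p.1) p.2⟩

instance (α β : Type) [BitRep α] [BitRep β] [FullRep α] [FullRep β] : FullRep (α × β) where
  enc_surjective x := by
    obtain ⟨a, ha⟩ := FullRep.enc_surjective (α := α) fun j => x (.inl j)
    obtain ⟨b, hb⟩ := FullRep.enc_surjective (α := β) fun j => x (.inr j)
    refine ⟨(a, b), funext fun j => ?_⟩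
    cases j with
    | inl j => exact congrFun ha j
    | inr j => exact congrFun hb j

/-- The length of the encodings of the elements of a type. -/
abbrev repLen (α : Type) [BitRep α] : ℕ := Fintype.card (BitRep.Idx α)

/-- Reading an element from a bit string. -/
noncomputable def unpack (α : Type) [BitRep α] [FullRep α] : Bits (repLen α) ≃ α :=
  (Equiv.arrowCongr (Fintype.equivFin (BitRep.Idx α)).symm (Equiv.refl Bool)).trans
    (Equiv.ofBijective _ ⟨BitRep.enc_injective, FullRep.enc_surjective (α := α)⟩).symm

theorem enc_unpack {α : Type} [BitRep α] [FullRep α] (b : Bits (repLen α)) (j : BitRep.Idx α) :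
    BitRep.enc (unpack α b) j = b (Fintype.equivFin _ j) :=
  congrFun ((Equiv.ofBijective _
    ⟨BitRep.enc_injective, FullRep.enc_surjective (α := α)⟩).apply_symm_apply _) j

namespace Eff
variable {α τ : ℕ → Type} [∀ k, BitRep (α k)] [∀ k, BitRep (τ k)] [∀ k, FullRep (τ k)]

theorem unpack (hτ : Small τ) {f : ∀ k, α k → Bits (repLen (τ k))} (hf : Eff f) :
    Eff fun k a => unpack (τ k) (f k a) :=
  (of_wiring (f := fun k (b : Bits (repLen (τ k))) => SecureBoost.unpack (τ k) b) hf.small_cod hτ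
    (fun _ j => .inl (Fintype.equivFin _ j, ())) fun _ _ _ => (enc_unpack _ _).symm).comp hf

theorem pack {f : ∀ k, α k → τ k} (hf : Eff f) :
    Eff fun k a => (SecureBoost.unpack (τ k)).symm (f k a) :=
  (of_wiring (f := fun k (t : τ k) => (SecureBoost.unpack (τ k)).symm t) hf.small_cod
    (Small.bits hf.small_cod) (fun _ i => .inl ((Fintype.equivFin _).symm i.1))
    fun _ _ _ => rfl).comp hf

end Eff

/-! ### Probabilities and negligible functions -/

section Pr
variable {Ω Ω' : Type} [Fintype Ω] [Fintype Ω']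

theorem Pr_congr_equiv (e : Ω ≃ Ω') {E : Ω → Bool} {E' : Ω' → Bool} (h : ∀ ω, E ω = E' (e ω)) :
    Pr E = Pr E' := by
  unfold Pr
  rw [Fintype.card_congr e]
  congr 2
  exact Finset.card_equiv e fun ω => by simp [h]

theorem Pr_fst [Nonempty Ω'] (E : Ω → Bool) : Pr (fun ω : Ω × Ω' => E ω.1) = Pr E := by
  have h : (Finset.univ.filter fun ω : Ω × Ω' => E ω.1 = true) =
      (Finset.univ.filter fun ω => E ω = true) ×ˢ (Finset.univ : Finset Ω') := by
    ext ω
    simp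
  have h' : (Fintype.card Ω' : ℝ) ≠ 0 := by simp
  unfold Pr
  rw [h, Finset.card_product, Fintype.card_prod, Finset.card_univ]
  push_cast
  exact mul_div_mul_right _ _ h'

/-- Exchanging one entry of a vector with a separate value. -/
def swapEntry {ι X : Type} [DecidableEq ι] (i : ι) : (ι → X) × X ≃ (ι → X) × X where
  toFun p := (Function.update p.1 i p.2, p.1 i)
  invFun p := (Function.update p.1 i p.2, p.1 i)
  left_inv p := by simp
  right_inv p := by simp

/-- Resampling one entry of a uniformly random vector does not change its distribution. -/
theorem Pr_update {ι X : Type} [Fintype ι] [DecidableEq ι] [Fintype X] [Nonempty X] (i : ι)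
    (E : Ω → (ι → X) → Bool) :
    Pr (fun ω : (Ω × (ι → X)) × X => E ω.1.1 (Function.update ω.1.2 i ω.2)) =
      Pr fun ω : Ω × (ι → X) => E ω.1 ω.2 := by
  refine Eq.trans ?_ (Pr_fst (Ω' := X) fun ω : Ω × (ι → X) => E ω.1 ω.2)
  refine Pr_congr_equiv ((Equiv.prodAssoc _ _ _).trans
    (((Equiv.refl Ω).prodCongr (swapEntry i)).trans (Equiv.prodAssoc _ _ _).symm)) ?_
  intro ω
  rfl

/-- Resampling with the factors of the sample space in the order of the hybrid games. -/
theorem Pr_resample {T Y ι X : Type} [Fintype T] [Fintype Y] [Fintype ι] [DecidableEq ι]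
    [Fintype X] [Nonempty X] (i : ι) (E : T → Y → (ι → X) → Bool) :
    Pr (fun ω : (T × (ι → X)) × Y × X =>
        E ω.1.1 ω.2.1 (Function.update ω.1.2 i ω.2.2)) =
      Pr fun ω : (T × Y) × (ι → X) => E ω.1.1 ω.1.2 ω.2 := by
  refine Eq.trans ?_ (Pr_update i fun (p : T × Y) x => E p.1 p.2 x)
  exact Pr_congr_equiv ⟨fun ω => (((ω.1.1, ω.2.1), ω.1.2), ω.2.2),
    fun ω => ((ω.1.1.1, ω.1.2), ω.1.1.2, ω.2), fun _ => rfl, fun _ => rfl⟩ fun ω => rfl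

end Pr

/-- Two sequences of probabilities differ by a negligible amount. -/
def Close (p p' : ℕ → ℝ) : Prop := Negligible fun k => |p k - p' k|

theorem Negligible.of_le {f g : ℕ → ℝ} (hg : Negligible g) (h : ∀ k, |f k| ≤ g k) :
    Negligible f :=
  Asymptotics.SuperpolynomialDecay.trans_abs_le hg fun k => (h k).trans (le_abs_self _)

namespace Close
variable {p p' p'' : ℕ → ℝ}

theorem of_eq (h : ∀ k, p k = p' k) : Close p p' := by
  have : (fun k => |p k - p' k|) = fun _ => 0 := by
    funext k
    rw [h, sub_self, abs_zero]
  unfold Close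
  rw [this]
  exact Asymptotics.superpolynomialDecay_zero _ _

theorem symm (h : Close p p') : Close p' p := by
  unfold Close
  simp_rw [abs_sub_comm (p' _)]
  exact h

theorem trans (h : Close p p') (h' : Close p' p'') : Close p p'' :=
  Negligible.of_le (Asymptotics.SuperpolynomialDecay.add h h') fun k => by
    rw [abs_abs]
    exact abs_sub_le _ _ _

theorem congr {r r' : ℕ → ℝ} (h : Close p p') (e : ∀ k, r k = p k) (e' : ∀ k, r' k = p' k) :
    Close r r' := by
  obtain rfl : r = p := funext e
  obtain rfl : r' = p' := funext e'
  exact h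

/-- The hybrid argument: the ends of a chain of polynomial length are close if all neighbours
are, at places that may depend on the security parameter. -/
theorem of_chain {m : ℕ → ℕ} (hm : PolyBdd m) (h : ℕ → ℕ → ℝ)
    (H : ∀ i : ℕ → ℕ, Negligible fun k =>
      if i k < m k then |h k (i k) - h k (i k + 1)| else 0) :
    Close (fun k => h k 0) fun k => h k (m k) := by
  -- the place with the largest difference
  have hi : ∀ k, ∃ i : ℕ, ∀ j < m k, i < m k ∧
      |h k j - h k (j + 1)| ≤ |h k i - h k (i + 1)| := by
    intro k
    rcases Nat.eq_zero_or_pos (m k) with h0 | h0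
    · exact ⟨0, fun j hj => by omega⟩
    · obtain ⟨i, hi, hmax⟩ := Finset.exists_max_image (Finset.range (m k))
        (fun j => |h k j - h k (j + 1)|) ⟨0, by simpa using h0⟩
      exact ⟨i, fun j hj => ⟨by simpa using hi, hmax j (by simpa using hj)⟩⟩
  choose i hi using hi
  obtain ⟨p, hp⟩ := hm
  refine Negligible.of_le ((H i).polynomial_mul (p.map (Nat.castRingHom ℝ))) fun k => ?_
  rw [abs_abs]
  have hpk : ((m k : ℕ) : ℝ) ≤ (p.map (Nat.castRingHom ℝ)).eval (k : ℝ) := by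
    rw [Polynomial.eval_natCast_map]
    exact Nat.cast_le.2 (hp k)
  set b : ℝ := if i k < m k then |h k (i k) - h k (i k + 1)| else 0 with hb
  have hb0 : 0 ≤ b := by
    rw [hb]
    split_ifs
    exacts [abs_nonneg _, le_rfl]
  refine le_trans ?_ (mul_le_mul_of_nonneg_right hpk hb0)
  have hsum : ∀ t ≤ m k, |h k 0 - h k t| ≤ t * b := by
    intro t
    induction t with
    | zero => intro _; simp
    | succ t ih =>
      intro ht
      obtain ⟨h1, h2⟩ := hi k t ht
      have h3 : |h k t - h k (t + 1)| ≤ b := by rwa [hb, if_pos h1]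
      have h4 := abs_sub_le (h k 0) (h k t) (h k (t + 1))
      have h5 := ih (by omega)
      push_cast
      linarith
  exact hsum _ le_rfl

end Close

/-! ### Chosen-plaintext games with many challenges -/

section Games
variable {Y X U M T : ℕ → Type} {Ct : ℕ → Type} [∀ k, Fintype (Y k)] [∀ k, Fintype (X k)]
  [∀ k, BitRep (U k)] [∀ k, BitRep (M k)] [∀ k, BitRep (Ct k)]

/-- The common form of the games for encryption, the homomorphic identity and garbling. There are
a long-term secret from `Y` with a public part in `U`, and two ways of computing a challenge
in `Ct` from the public part, a message from `M` and coins from `X`. No efficient adversary, which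
chooses the message when it knows the public part, tells the two ways apart. -/
def Indist (pub : ∀ k, Y k → U k) (s s' : ∀ k, U k × M k × X k → Ct k) : Prop :=
  ∀ (r : ℕ → ℕ) (choose : ∀ k, Bits (r k) × U k → M k)
    (guess : ∀ k, Bits (r k) × U k × Ct k → Bool), Eff choose → Eff guess →
    Close
      (fun k => Pr fun ω : Bits (r k) × Y k × X k => guess k (ω.1, pub k ω.2.1,
        s k (pub k ω.2.1, choose k (ω.1, pub k ω.2.1), ω.2.2)))
      (fun k => Pr fun ω : Bits (r k) × Y k × X k => guess k (ω.1, pub k ω.2.1,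
        s' k (pub k ω.2.1, choose k (ω.1, pub k ω.2.1), ω.2.2)))

variable [∀ k, Fintype (T k)] [∀ k, BitRep (T k)] [∀ k, FullRep (T k)]
  {pub : ∀ k, Y k → U k} {s s' : ∀ k, U k × M k × X k → Ct k}

/-- The adversary may use coins of any type that is in bijection with bit strings. -/
theorem Indist.of_coins (h : Indist pub s s') (hT : Small T)
    {choose : ∀ k, T k × U k → M k} {guess : ∀ k, T k × U k × Ct k → Bool}
    (hc : Eff choose) (hg : Eff guess) :
    Close
      (fun k => Pr fun ω : T k × Y k × X k => guess k (ω.1, pub k ω.2.1,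
        s k (pub k ω.2.1, choose k (ω.1, pub k ω.2.1), ω.2.2)))
      (fun k => Pr fun ω : T k × Y k × X k => guess k (ω.1, pub k ω.2.1,
        s' k (pub k ω.2.1, choose k (ω.1, pub k ω.2.1), ω.2.2))) := by
  have hid := Eff.id (Small.bits hT |>.prod hc.small_dom.snd)
  have hid' := Eff.id (Small.bits hT |>.prod hg.small_dom.snd)
  refine (h (fun k => repLen (T k)) (fun k p => choose k (unpack _ p.1, p.2))
    (fun k p => guess k (unpack _ p.1, p.2))
    (hc.comp ((Eff.unpack hT hid.fst).pair hid.snd))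
    (hg.comp ((Eff.unpack hT hid'.fst).pair hid'.snd))).congr (fun k => ?_) fun k => ?_
  all_goals
    exact (Pr_congr_equiv ((unpack (T k)).prodCongr (Equiv.refl _)) fun ω => rfl).symm

/-- The hybrid argument for the games: the adversary may ask for a vector of challenges. -/
theorem Indist.pi [∀ k, BitRep (X k)] [∀ k, FullRep (X k)] (h : Indist pub s s') (hT : Small T)
    {J : ℕ → Type} [∀ k, Fintype (J k)] [∀ k, DecidableEq (J k)]
    (hJ : PolyBdd fun k => Fintype.card (J k))
    [∀ k, Nonempty (X k)] [∀ k, Nonempty (M k)] (hM : Small M) (hs : Eff s) (hs' : Eff s')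
    {choose : ∀ k, T k × U k → J k → M k} {guess : ∀ k, T k × U k × (J k → Ct k) → Bool}
    (hc : Eff choose) (hg : Eff guess) :
    Close
      (fun k => Pr fun ω : (T k × Y k) × (J k → X k) => guess k (ω.1.1, pub k ω.1.2, fun j =>
        s k (pub k ω.1.2, choose k (ω.1.1, pub k ω.1.2) j, ω.2 j)))
      (fun k => Pr fun ω : (T k × Y k) × (J k → X k) => guess k (ω.1.1, pub k ω.1.2, fun j =>
        s' k (pub k ω.1.2, choose k (ω.1.1, pub k ω.1.2) j, ω.2 j))) := by
  classical
  have hX : Small X := hs.small_dom.snd.snd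
  have hU : Small U := hs.small_dom.fst
  have hCt : Small Ct := hs.small_cod
  let e : ∀ k, J k ≃ Fin (Fintype.card (J k)) := fun k => Fintype.equivFin (J k)
  -- in hybrid `i` the first `i` challenges are of the second kind
  let mixed : ∀ (k i : ℕ) (t : T k) (u : U k) (x : J k → X k) (j : J k), Ct k :=
    fun k i t u x j => if (e k j).val < i then s' k (u, choose k (t, u) j, x j)
      else s k (u, choose k (t, u) j, x j)
  let H : ℕ → ℕ → ℝ := fun k i => Pr fun ω : (T k × Y k) × (J k → X k) =>
    guess k (ω.1.1, pub k ω.1.2, mixed k i ω.1.1 (pub k ω.1.2) ω.2)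
  refine (Close.of_chain hJ H ?_).congr (fun k => ?_) fun k => ?_
  · intro i
    -- the entry in which hybrids `i` and `i + 1` differ
    let j₀ : ∀ k, Option (J k) := fun k =>
      if hi : i k < Fintype.card (J k) then some ((e k).symm ⟨i k, hi⟩) else none
    let m₀ : ∀ k, M k := fun k => Classical.arbitrary (M k)
    let choose' : ∀ k, (T k × (J k → X k)) × U k → M k := fun k p =>
      (j₀ k).elim (m₀ k) (choose k (p.1.1, p.2))
    let guess' : ∀ k, (T k × (J k → X k)) × U k × Ct k → Bool := fun k p =>
      guess k (p.1.1, p.2.1, fun j => if j₀ k = some j then p.2.2 else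
        mixed k (i k) p.1.1 p.2.1 p.1.2 j)
    have hid := Eff.id ((hT.prod (hX.pi hJ)).prod hU)
    have hc' : Eff choose' := Eff.piElim j₀ m₀ hM (hc.comp (hid.fst.fst.pair hid.snd))
    have hid' := Eff.id ((hT.prod (hX.pi hJ)).prod (hU.prod hCt))
    have harg := (Eff.piConst hJ hid'.snd.fst).piPair
      ((hc.comp (hid'.fst.fst.pair hid'.snd.fst)).piPair hid'.fst.snd)
    have hg' : Eff guess' := hg.comp (hid'.fst.fst.pair (hid'.snd.fst.pair
      (Eff.piIte (fun k j => j₀ k = some j) (Eff.piConst hJ hid'.snd.snd)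
        (Eff.piIte (fun k j => (e k j).val < i k) (hs'.map hJ harg) (hs.map hJ harg)))))
    refine Negligible.of_le (h.of_coins (hT.prod (hX.pi hJ)) hc' hg') fun k => ?_
    split_ifs with hi
    · rw [abs_abs]
      refine le_of_eq (congrArg abs (congrArg₂ _ ?_ ?_))
      all_goals
        have hj₀ : j₀ k = some ((e k).symm ⟨i k, hi⟩) := dif_pos hi
      · refine (Pr_resample ((e k).symm ⟨i k, hi⟩) fun t y x =>
          guess k (t, pub k y, mixed k (i k) t (pub k y) x)).symm.trans
            (congrArg Pr (funext fun ω => ?_))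
        refine congrArg (fun v => guess k (ω.1.1, pub k ω.2.1, v)) (funext fun j => ?_)
        by_cases hj : j = (e k).symm ⟨i k, hi⟩
        · subst hj
          simp [mixed, choose', hj₀]
        · have hj' : j₀ k ≠ some j := by rw [hj₀]; simpa using Ne.symm hj
          simp [mixed, hj', hj]
      · refine (Pr_resample ((e k).symm ⟨i k, hi⟩) fun t y x =>
          guess k (t, pub k y, mixed k (i k + 1) t (pub k y) x)).symm.trans
            (congrArg Pr (funext fun ω => ?_))
        refine congrArg (fun v => guess k (ω.1.1, pub k ω.2.1, v)) (funext fun j => ?_)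
        by_cases hj : j = (e k).symm ⟨i k, hi⟩
        · subst hj
          simp [mixed, choose', hj₀]
        · have hj' : j₀ k ≠ some j := by rw [hj₀]; simpa using Ne.symm hj
          have hj'' : (e k j).val < i k + 1 ↔ (e k j).val < i k := by
            have : (e k j).val ≠ i k := fun h => hj (by
              rw [Equiv.eq_symm_apply]; exact Fin.ext h)
            omega
          simp [mixed, hj', hj, hj'']
    · simp
  · simp [H, mixed]
  · simp [H, mixed]

end Games

/-! ### Executions as functions of a table of views -/

section Execution
variable {P : Params} {V : ℕ → Type} [∀ k, BitRep (V k)] {auxE auxA envMsg advMsg : ℕ → ℕ}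
  (E : Environment P auxE envMsg advMsg) (A : Adversary V auxA envMsg advMsg) {k : ℕ}

/-- The configuration after `i` activations of the environment. -/
def runFor (W : World P (V k) k) (mE : Bits (auxE k)) (mA : Bits (auxA k))
    (ρ : Bits (E.coins k) × Bits (A.coins k)) (i : ℕ) :
    Config P (E.stateLen k) (A.stateLen k) (advMsg k) k :=
  (round E A k W)^[i] ⟨E.init k (mE, ρ.1), A.init k (mA, ρ.2), 0, 0, fun _ => false⟩

/-- The input at the end of an execution: the one that the environment has chosen when the
execution went to phase `2`, or `0` if it never did. -/
def finalInput (W : World P (V k) k) (mE : Bits (auxE k)) (mA : Bits (auxA k))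
    (ρ : Bits (E.coins k) × Bits (A.coins k)) : P.Input k :=
  (runFor E A W mE mA ρ (E.rounds k)).input

/-- A world that does not depend on the input any more. -/
def World.ofTables {V : Type} (v : Fin 6 → V) (o : Fin 6 → Option (P.Indicator k)) :
    World P V k :=
  ⟨fun p _ => v p, fun p _ => o p⟩

variable {E A}

theorem le_nextPhase (p : Fin 6) : p ≤ nextPhase p := by
  revert p
  decide

theorem round_freezes (W : World P (V k) k)
    (c : Config P (E.stateLen k) (A.stateLen k) (advMsg k) k) (h : 2 ≤ c.phase) :
    2 ≤ (round E A k W c).phase ∧ (round E A k W c).input = c.input := by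
  have h1 : c.phase ≠ 1 := by
    intro h1
    rw [h1] at h
    exact absurd h (by decide)
  refine ⟨?_, by simp [round, h1]⟩
  simp only [round]
  split_ifs
  · exact h.trans (le_nextPhase _)
  · exact h

theorem runFor_succ (W : World P (V k) k) (mE : Bits (auxE k)) (mA : Bits (auxA k))
    (ρ : Bits (E.coins k) × Bits (A.coins k)) (i : ℕ) :
    runFor E A W mE mA ρ (i + 1) = round E A k W (runFor E A W mE mA ρ i) :=
  Function.iterate_succ_apply' _ _ _

theorem runFor_freezes (W : World P (V k) k) (mE : Bits (auxE k)) (mA : Bits (auxA k))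
    (ρ : Bits (E.coins k) × Bits (A.coins k)) {i : ℕ}
    (h : 2 ≤ (runFor E A W mE mA ρ i).phase) (j : ℕ) :
    2 ≤ (runFor E A W mE mA ρ (i + j)).phase ∧
      (runFor E A W mE mA ρ (i + j)).input = (runFor E A W mE mA ρ i).input := by
  induction j with
  | zero => exact ⟨h, rfl⟩
  | succ j ih =>
    rw [← Nat.add_assoc, runFor_succ]
    have := round_freezes W _ ih.1
    exact ⟨this.1, this.2.trans ih.2⟩

theorem round_congr {W W' : World P (V k) k}
    {c : Config P (E.stateLen k) (A.stateLen k) (advMsg k) k}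
    (ho : W.out c.phase c.input = W'.out c.phase c.input)
    (hv : W.view (round E A k W c).phase (round E A k W c).input =
      W'.view (round E A k W c).phase (round E A k W c).input) :
    round E A k W c = round E A k W' c := by
  simp only [round] at hv ⊢
  rw [hv, ho]

/-- The input depends only on what is visible before phase `2`. -/
theorem finalInput_congr {W W' : World P (V k) k} (hv : ∀ p < 2, ∀ x, W.view p x = W'.view p x)
    (ho : ∀ p < 2, ∀ x, W.out p x = W'.out p x) (mE : Bits (auxE k)) (mA : Bits (auxA k))
    (ρ : Bits (E.coins k) × Bits (A.coins k)) :
    finalInput E A W mE mA ρ = finalInput E A W' mE mA ρ := by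
  have key : ∀ i, (runFor E A W mE mA ρ i = runFor E A W' mE mA ρ i ∧
        (runFor E A W mE mA ρ i).phase < 2) ∨
      (2 ≤ (runFor E A W mE mA ρ i).phase ∧ 2 ≤ (runFor E A W' mE mA ρ i).phase ∧
        (runFor E A W mE mA ρ i).input = (runFor E A W' mE mA ρ i).input) := by
    intro i
    induction i with
    | zero => exact Or.inl ⟨rfl, show (0 : Fin 6) < 2 by decide⟩
    | succ i ih =>
      rw [runFor_succ, runFor_succ]
      rcases ih with ⟨he, hp⟩ | ⟨h1, h2, h3⟩
      · rw [← he]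
        set c := runFor E A W mE mA ρ i
        have hoc := ho c.phase hp c.input
        by_cases hr : (round E A k W c).phase < 2
        · exact Or.inl ⟨round_congr hoc (hv _ hr _), hr⟩
        · have hph : (round E A k W' c).phase = (round E A k W c).phase := by
            simp only [round]
            rw [hoc]
          have hin : (round E A k W c).input = (round E A k W' c).input := by
            simp only [round]
            rw [hoc]
          exact Or.inr ⟨not_lt.1 hr, hph ▸ not_lt.1 hr, hin⟩
      · have h4 := round_freezes W _ h1
        have h5 := round_freezes W' _ h2
        exact Or.inr ⟨h4.1, h5.1, by rw [h4.2, h5.2, h3]⟩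
  rcases key (E.rounds k) with h | h
  · exact congrArg Config.input h.1
  · exact h.2.2

theorem exec_congr {W W' : World P (V k) k} {mE : Bits (auxE k)} {mA : Bits (auxA k)}
    {ρ : Bits (E.coins k) × Bits (A.coins k)}
    (hv : ∀ p x, p < 2 ∨ x = finalInput E A W mE mA ρ → W.view p x = W'.view p x)
    (ho : ∀ p x, p < 2 ∨ x = finalInput E A W mE mA ρ → W.out p x = W'.out p x) :
    exec E A k W mE mA ρ.1 ρ.2 = exec E A k W' mE mA ρ.1 ρ.2 := by
  have hx : ∀ i ≤ E.rounds k, (runFor E A W mE mA ρ i).phase < 2 ∨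
      (runFor E A W mE mA ρ i).input = finalInput E A W mE mA ρ := by
    intro i hi
    by_cases h : (runFor E A W mE mA ρ i).phase < 2
    · exact Or.inl h
    · have := (runFor_freezes W mE mA ρ (not_lt.1 h) (E.rounds k - i)).2
      rw [Nat.add_sub_cancel' hi] at this
      exact Or.inr this.symm
  have key : ∀ i ≤ E.rounds k, runFor E A W mE mA ρ i = runFor E A W' mE mA ρ i := by
    intro i
    induction i with
    | zero => intro _; rfl
    | succ i ih =>
      intro hi
      have h := hx (i + 1) hi
      rw [runFor_succ] at h
      rw [runFor_succ, runFor_succ, ← ih (by omega)]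
      exact round_congr (ho _ _ (hx i (by omega))) (hv _ _ h)
  exact congrArg (fun c => E.verdict k c.env) (key _ le_rfl)

/-- An execution is determined by the views and outputs at the input that is chosen in it, and
this input by the views before phase `2`, which do not depend on any input. -/
theorem exec_eq_ofTables {W : World P (V k) k} {v : Fin 6 → V k}
    {o : Fin 6 → Option (P.Indicator k)} (hv : ∀ p < 2, ∀ x, W.view p x = v p)
    (ho : ∀ p < 2, ∀ x, W.out p x = o p) (mE : Bits (auxE k)) (mA : Bits (auxA k))
    (ρ : Bits (E.coins k) × Bits (A.coins k)) {x : P.Input k}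
    (hx : x = finalInput E A (World.ofTables v o) mE mA ρ) :
    exec E A k W mE mA ρ.1 ρ.2 =
      exec E A k (World.ofTables (fun p => W.view p x) fun p => W.out p x) mE mA ρ.1 ρ.2 := by
  have hx' : x = finalInput E A W mE mA ρ :=
    hx.trans (finalInput_congr (fun p hp x => (hv p hp x).symm) (fun p hp x => (ho p hp x).symm)
      mE mA ρ)
  refine exec_congr (fun p y h => ?_) fun p y h => ?_
  · rcases h with h | h
    · exact (hv p h y).trans (hv p h x).symm
    · rw [h, ← hx']
      rfl
  · rcases h with h | h
    · exact (ho p h y).trans (ho p h x).symm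
    · rw [h, ← hx']
      rfl

/-! ### Efficiency of executions -/

variable (E A)

/-- The tables together with the components of a configuration. -/
abbrev TableConfig (k : ℕ) : Type :=
  ((Fin 6 → V k) × (Fin 6 → Option (P.Indicator k))) ×
    (Bits (E.stateLen k) × Bits (A.stateLen k)) × (Fin 6 × P.Input k) × Bits (advMsg k)

/-- The configuration described by its components. -/
def TableConfig.config {E : Environment P auxE envMsg advMsg}
    {A : Adversary V auxA envMsg advMsg} (t : TableConfig E A k) :
    Config P (E.stateLen k) (A.stateLen k) (advMsg k) k :=
  ⟨t.2.1.1, t.2.1.2, t.2.2.1.1, t.2.2.1.2, t.2.2.2⟩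

/-- One activation of the environment and one of the adversary, on components. -/
def tableRound (k : ℕ) (t : TableConfig E A k) : TableConfig E A k :=
  let c := round E A k (World.ofTables t.1.1 t.1.2) t.config
  (t.1, (c.env, c.adv), (c.phase, c.input), c.reply)

theorem round_eq_cond (W : World P (V k) k)
    (c : Config P (E.stateLen k) (A.stateLen k) (advMsg k) k) :
    round E A k W c =
      (let e := E.step k (c.env, c.reply, W.out c.phase c.input)
      let phase := bif e.2.1 then nextPhase c.phase else c.phase
      let input := bif e.2.1 then bif decide (c.phase = 1) then e.2.2.1 else c.input else c.input
      let a := A.step k (c.adv, W.view phase input, e.2.2.2)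
      ⟨e.1, a.1, phase, input, a.2⟩) := by
  unfold round
  generalize E.step k (c.env, c.reply, W.out c.phase c.input) = e
  obtain ⟨e, b, y, m⟩ := e
  by_cases hp : c.phase = 1 <;> cases b <;> simp [hp]

theorem tableRound_eff : Eff (tableRound E A) := by
  have hV : Small V := A.step_eff.small_dom.snd.fst
  have hout : Small fun k => Option (P.Indicator k) := E.step_eff.small_dom.snd.snd
  have hin : Small P.Input := E.step_eff.small_cod.snd.snd.fst
  have hreply : Small fun k => Bits (advMsg k) := A.step_eff.small_cod.snd
  have h6 : PolyBdd fun _ => Fintype.card (Fin 6) := .const _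
  have hid := Eff.id (((hV.pi h6).prod (hout.pi h6)).prod
    ((E.init_eff.small_cod.prod A.init_eff.small_cod).prod
      (((Small.fin 6).prod hin).prod hreply)))
  have he := E.step_eff.comp (hid.snd.fst.fst.pair (hid.snd.snd.snd.pair
    (Eff.lookup hid.fst.snd hid.snd.snd.fst.fst hout)))
  have hphase := he.snd.fst.cond
    (Eff.of_fin (Small.fin 6) (fun _ => nextPhase) hid.snd.snd.fst.fst) hid.snd.snd.fst.fst
  have hinput := he.snd.fst.cond
    ((Eff.of_fin Small.bool (fun _ p => decide (p = 1)) hid.snd.snd.fst.fst).cond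
      he.snd.snd.fst hid.snd.snd.fst.snd) hid.snd.snd.fst.snd
  have ha := A.step_eff.comp (hid.snd.fst.snd.pair ((Eff.lookup hid.fst.fst hphase hV).pair
    he.snd.snd.snd))
  have h := hid.fst.pair ((he.fst.pair ha.fst).pair ((hphase.pair hinput).pair ha.snd))
  convert h using 3 with k t
  obtain ⟨T, c, ⟨p, x⟩, m⟩ := t
  simp only [tableRound, round_eq_cond, TableConfig.config, World.ofTables]

theorem tableRound_iterate (i : ℕ) (t : TableConfig E A k) :
    ((tableRound E A k)^[i] t).1 = t.1 ∧ ((tableRound E A k)^[i] t).config =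
      (round E A k (World.ofTables t.1.1 t.1.2))^[i] t.config := by
  induction i with
  | zero => exact ⟨rfl, rfl⟩
  | succ i ih =>
    rw [Function.iterate_succ_apply', Function.iterate_succ_apply', ← ih.2]
    refine ⟨ih.1, ?_⟩
    rw [← ih.1]
    rfl

/-- The coins of environment and adversary, and the tables that they see. -/
abbrev TableArg (k : ℕ) : Type :=
  (Bits (E.coins k) × Bits (A.coins k)) ×
    (Fin 6 → V k) × (Fin 6 → Option (P.Indicator k))

theorem tableRun_eff (mE : ∀ k, Bits (auxE k)) (mA : ∀ k, Bits (auxA k)) :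
    Eff fun k (t : TableArg E A k) => (tableRound E A k)^[E.rounds k]
      (t.2, (E.init k (mE k, t.1.1), A.init k (mA k, t.1.2)), (0, 0), fun _ => false) := by
  have hV : Small V := A.step_eff.small_dom.snd.fst
  have hout : Small fun k => Option (P.Indicator k) := E.step_eff.small_dom.snd.snd
  have hin : Small P.Input := E.step_eff.small_cod.snd.snd.fst
  have hreply : Small fun k => Bits (advMsg k) := A.step_eff.small_cod.snd
  have h6 : PolyBdd fun _ => Fintype.card (Fin 6) := .const _
  have hid := Eff.id ((E.init_eff.small_dom.snd.prod A.init_eff.small_dom.snd).prod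
    ((hV.pi h6).prod (hout.pi h6)))
  have hconst := Eff.const hid.small_dom (((Small.fin 6).prod hin).prod hreply)
    fun _ => ((0, 0), fun _ => false)
  exact ((tableRound_eff E A).iterate E.rounds_le).comp (hid.snd.pair
    (((E.init_eff.comp ((Eff.const hid.small_dom E.init_eff.small_dom.fst mE).pair
      hid.fst.fst)).pair (A.init_eff.comp ((Eff.const hid.small_dom A.init_eff.small_dom.fst
      mA).pair hid.fst.snd))).pair hconst))

theorem exec_ofTables_eff (mE : ∀ k, Bits (auxE k)) (mA : ∀ k, Bits (auxA k)) :
    Eff fun k (t : TableArg E A k) =>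
      exec E A k (World.ofTables t.2.1 t.2.2) (mE k) (mA k) t.1.1 t.1.2 := by
  refine Eq.mp (congrArg Eff ?_) (E.verdict_eff.comp (tableRun_eff E A mE mA).snd.fst.fst)
  funext k t
  exact congrArg (fun c => E.verdict k c.env) (tableRound_iterate E A (E.rounds k)
    (t.2, (E.init k (mE k, t.1.1), A.init k (mA k, t.1.2)), (0, 0), fun _ => false)).2

theorem finalInput_ofTables_eff (mE : ∀ k, Bits (auxE k)) (mA : ∀ k, Bits (auxA k)) :
    Eff fun k (t : TableArg E A k) =>
      finalInput E A (World.ofTables t.2.1 t.2.2) (mE k) (mA k) t.1 := by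
  refine Eq.mp (congrArg Eff ?_) (tableRun_eff E A mE mA).snd.snd.fst.snd
  funext k t
  exact congrArg Config.input (tableRound_iterate E A (E.rounds k)
    (t.2, (E.init k (mE k, t.1.1), A.init k (mA k, t.1.2)), (0, 0), fun _ => false)).2

end Execution

/-! ### Simulators -/

section Simulation
variable {P : Params} {VR VI τ : ℕ → Type} [∀ k, BitRep (VR k)] [∀ k, BitRep (VI k)]
  [∀ k, BitRep (τ k)] [∀ k, FullRep (τ k)] {auxE auxA envMsg advMsg : ℕ → ℕ}

/-- The simulator that runs a given adversary on views which it makes up, by the function `sim`,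
from coins that it chooses at the beginning and from what it sees in the ideal process. -/
noncomputable def simulator (A : Adversary VR auxA envMsg advMsg) (hτ : Small τ)
    (sim : ∀ k, τ k × VI k → VR k) (hsim : Eff sim) : Adversary VI auxA envMsg advMsg where
  coins k := repLen (Bits (A.coins k) × τ k)
  stateLen k := repLen (Bits (A.stateLen k) × τ k)
  init k p := (unpack _).symm
    (A.init k (p.1, (unpack (Bits (A.coins k) × τ k) p.2).1), (unpack _ p.2).2)
  step k p :=
    ((unpack _).symm ((A.step k ((unpack (Bits (A.stateLen k) × τ k) p.1).1,
        sim k ((unpack (Bits (A.stateLen k) × τ k) p.1).2, p.2.1), p.2.2)).1,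
      (unpack (Bits (A.stateLen k) × τ k) p.1).2),
    (A.step k ((unpack (Bits (A.stateLen k) × τ k) p.1).1,
        sim k ((unpack (Bits (A.stateLen k) × τ k) p.1).2, p.2.1), p.2.2)).2)
  init_eff := by
    have hc := A.init_eff.small_dom.snd.prod hτ
    have hid := Eff.id (A.init_eff.small_dom.fst.prod (Small.bits hc))
    have hu := Eff.unpack hc hid.snd
    exact ((A.init_eff.comp (hid.fst.pair hu.fst)).pair hu.snd).pack
  step_eff := by
    have hc := A.init_eff.small_cod.prod hτ
    have hid := Eff.id ((Small.bits hc).prod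
      (hsim.small_dom.snd.prod A.step_eff.small_dom.snd.snd))
    have hu := Eff.unpack hc hid.fst
    have ha := A.step_eff.comp (hu.fst.pair ((hsim.comp (hu.snd.pair hid.snd.fst)).pair
      hid.snd.snd))
    exact (ha.fst.pair hu.snd).pack.pair ha.snd

theorem exec_simulator (E : Environment P auxE envMsg advMsg)
    (A : Adversary VR auxA envMsg advMsg) (hτ : Small τ)
    (sim : ∀ k, τ k × VI k → VR k) (hsim : Eff sim) {k : ℕ} (W : World P (VI k) k)
    (mE : Bits (auxE k)) (mA : Bits (auxA k)) (ρE : Bits (E.coins k))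
    (ρ : Bits (A.coins k)) (t : τ k) :
    exec E (simulator A hτ sim hsim) k W mE mA ρE ((unpack _).symm (ρ, t)) =
      exec E A k ⟨fun p x => sim k (t, W.view p x), W.out⟩ mE mA ρE ρ := by
  let φ : Config P (E.stateLen k) (A.stateLen k) (advMsg k) k →
      Config P (E.stateLen k) ((simulator A hτ sim hsim).stateLen k) (advMsg k) k :=
    fun c => ⟨c.env, (unpack _).symm (c.adv, t), c.phase, c.input, c.reply⟩
  have hφ : Function.Semiconj φ (round E A k ⟨fun p x => sim k (t, W.view p x), W.out⟩)
      (round E (simulator A hτ sim hsim) k W) := by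
    intro c
    simp [φ, round, simulator]
  have h := (hφ.iterate_right (E.rounds k))
    ⟨E.init k (mE, ρE), A.init k (mA, ρ), 0, 0, fun _ => false⟩
  have hinit : φ ⟨E.init k (mE, ρE), A.init k (mA, ρ), 0, 0, fun _ => false⟩ =
      ⟨E.init k (mE, ρE), (simulator A hτ sim hsim).init k (mA, (unpack _).symm (ρ, t)), 0, 0,
        fun _ => false⟩ := by
    simp [φ, simulator]
  unfold exec
  rw [← hinit, ← h]

end Simulation

/-! ### Arithmetic and sign checking by means of the primitives -/

section Arithmetic
variable {P : Params}

theorem bitLen_pos (P : Params) (k : ℕ) : 0 < bitLen (P.q k) :=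
  Nat.clog_pos (by norm_num) (P.two_le_q k)

theorem polyBdd_of_small_vector {m : ℕ → ℕ} (h : Small fun k => Fin (m k) → P.R k) :
    PolyBdd fun k => Fintype.card (Fin (m k)) :=
  h.mono fun k => by
    have h1 : Fintype.card (BitRep.Idx (Fin (m k) → P.R k)) = m k * bitLen (P.q k) :=
      (Fintype.card_prod (Fin (m k)) (Fin (bitLen (P.q k)))).trans (by simp)
    rw [h1, Fintype.card_fin]
    exact Nat.le_mul_of_pos_right _ (bitLen_pos P k)

theorem Generator.polyBdd_n (G : Generator P) : PolyBdd fun k => Fintype.card (Fin (P.n k)) :=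
  polyBdd_of_small_vector G.gen_eff.small_cod

theorem HEScheme.polyBdd_d (HE : HEScheme P) : PolyBdd fun k => Fintype.card (Fin (P.d k)) :=
  polyBdd_of_small_vector HE.dot_eff.small_dom.snd.snd

/-- Circuits for the arithmetic modulo `q` are obtained from the encryption scheme: encrypt with
a fixed key and fixed coins, evaluate homomorphically, and decrypt. -/
theorem HEScheme.dotProduct_add_eff (HE : HEScheme P) :
    Eff fun k (p : P.Classifier k × P.Classifier k × P.R k) =>
      (∑ j, p.1 j * p.2.1 j) + p.2.2 := by
  have hw : Small P.Classifier := HE.dot_eff.small_dom.snd.snd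
  have hid := Eff.id (hw.prod (hw.prod HE.enc_eff.small_dom.snd.fst))
  let κ : ∀ k, Bits (HE.keyCoins k) := fun _ _ => false
  have hpk := Eff.const hid.small_dom HE.enc_eff.small_dom.fst fun k => (HE.keygen k (κ k)).1
  have hsk := Eff.const hid.small_dom HE.dec_eff.small_dom.fst fun k => (HE.keygen k (κ k)).2
  have hρ := Eff.const hid.small_dom HE.enc_eff.small_dom.snd.snd fun _ _ => false
  have hz := HE.enc_eff.map HE.polyBdd_d ((Eff.piConst HE.polyBdd_d hpk).piPair
    (hid.fst.piPair (Eff.piConst HE.polyBdd_d hρ)))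
  have h := HE.dec_eff.comp (hsk.pair (HE.add_eff.comp (hpk.pair
    ((HE.dot_eff.comp (hpk.pair (hz.pair hid.snd.fst))).pair
      (HE.enc_eff.comp (hpk.pair (hid.snd.snd.pair hρ)))))))
  refine Eq.mp (congrArg Eff ?_) h
  funext k p
  exact HE.dec_add_dot k (κ k) p.1 p.2.1 p.2.2 (fun _ _ => false) fun _ => false

theorem HEScheme.noisyPrediction_eff (HE : HEScheme P) (G : Generator P) :
    Eff fun k (p : P.Input k × P.Vec k) i => (∑ j, p.1.1 i j * p.1.2 j) + p.2 i := by
  have hw : Small P.Classifier := HE.dot_eff.small_dom.snd.snd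
  have hid := Eff.id (((hw.pi G.polyBdd_n).prod hw).prod G.gen_eff.small_cod)
  have h := HE.dotProduct_add_eff.map G.polyBdd_n
    (hid.fst.fst.piPair ((Eff.piConst G.polyBdd_n hid.fst.snd).piPair hid.snd))
  exact h

theorem wireBits_eff (G : Generator P) :
    Eff fun k (p : P.Vec k × P.Vec k) => wireBits P k p.1 p.2 := by
  have hv : Small P.Vec := G.gen_eff.small_cod
  refine Eff.of_wiring (hv.prod hv) ((hv.prod hv).mono fun k => le_of_eq ?_)
    (fun k (j : P.Wire k × Unit) => .inl j.1) fun k p j => ?_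
  · exact Fintype.card_congr (Equiv.prodPUnit (P.Wire k))
  · obtain ⟨j | j, u⟩ := j <;> rfl

variable {C : ∀ k, Circuit (Fin (P.n k)) (P.Wire k)}

/-- Circuits for sign checking are obtained from a fixed garbled circuit. This takes the role
of `C` itself, whose size is not subject to any bound. -/
theorem GarbledCircuit.not_signBit_eff (GC : GarbledCircuit C) (G : Generator P)
    (hC : ComputesSigns P C) :
    Eff fun k (p : P.Vec k × P.Vec k) i => !signBit (p.1 i - p.2 i) := by
  have hv : Small P.Vec := G.gen_eff.small_cod
  have hid := Eff.id (hv.prod hv)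
  let ρ : ∀ k, Bits (GC.coins k) := fun _ _ => false
  have hlab := (Eff.const hid.small_dom GC.garble_eff.small_cod.snd.fst
    fun k => (GC.garble k (ρ k)).2.1).select (wireBits_eff G) GC.evaluate_eff.small_dom.snd
  have hev := GC.evaluate_eff.comp ((Eff.const hid.small_dom GC.evaluate_eff.small_dom.fst
    fun k => (GC.garble k (ρ k)).1).pair hlab)
  have h := hev.piDecideEq (Eff.const hid.small_dom hev.small_cod
    fun k j => (GC.garble k (ρ k)).2.2 j false) G.polyBdd_n
  refine Eq.mp (congrArg Eff ?_) h
  funext k p i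
  simp only [GC.correct, hC k]
  have hne := GC.label_ne k (ρ k) i
  cases signBit (p.1 i - p.2 i)
  · simp
  · simpa using Ne.symm hne

theorem indicator_eff (HE : HEScheme P) (G : Generator P) (GC : GarbledCircuit C)
    (hC : ComputesSigns P C) :
    Eff (indicator P) := by
  have hw : Small P.Classifier := HE.dot_eff.small_dom.snd.snd
  have hid := Eff.id ((hw.pi G.polyBdd_n).prod hw)
  have h0 := Eff.const hid.small_dom G.gen_eff.small_cod fun k => (0 : P.Vec k)
  refine Eq.mp (congrArg Eff ?_) ((GC.not_signBit_eff G hC).comp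
    (((HE.noisyPrediction_eff G).comp (hid.pair h0)).pair h0))
  funext k x i
  simp [indicator]

/-- The labels of the output wires that encode an indicator vector. -/
theorem GarbledCircuit.labels_eff (GC : GarbledCircuit C) (G : Generator P) :
    Eff fun k (p : Bits (GC.coins k) × P.Indicator k) i => (GC.garble k p.1).2.2 i (!p.2 i) := by
  have hI : Small P.Indicator := Small.bool.pi G.polyBdd_n
  have hid := Eff.id (GC.garble_eff.small_dom.prod hI)
  have hb := Eff.id Small.bool
  have hnot : Eff fun _ (b : Bool) => !b := by
    refine Eq.mp (congrArg Eff ?_) (hb.cond (Eff.const Small.bool Small.bool fun _ => false)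
      (Eff.const Small.bool Small.bool fun _ => true))
    funext _ b
    cases b <;> rfl
  exact (GC.garble_eff.comp hid.fst).snd.snd.select (hnot.map G.polyBdd_n hid.snd)
    GC.evaluate_eff.small_cod

end Arithmetic

/-! ### Correctness of the protocol -/

section Correctness
variable {P : Params} {G : Generator P} {HE : HEScheme P}
  {C : ∀ k, Circuit (Fin (P.n k)) (P.Wire k)} {GC : GarbledCircuit C} {k : ℕ}

theorem Coins.noisy_eq (ω : Coins G HE GC k) (x : P.Input k) :
    ω.noisy x = fun i => (∑ j, x.1 i j * x.2 j) + ω.noiseVec i :=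
  funext fun i => HE.dec_add_dot k ω.key (x.1 i) x.2 _ _ _

theorem Coins.outputLabels_eq (hC : ComputesSigns P C) (ω : Coins G HE GC k) (x : P.Input k) :
    ω.outputLabels x = fun i => (GC.garble k ω.garbling).2.2 i (!indicator P k x i) := by
  refine (GC.correct k ω.garbling _).trans (funext fun i => ?_)
  rw [hC k, Coins.noisy_eq]
  simp [indicator]

theorem Coins.output_eq (hC : ComputesSigns P C) (ω : Coins G HE GC k) (x : P.Input k) :
    ω.output x = indicator P k x := by
  funext i
  have hne := GC.label_ne k ω.garbling i
  simp only [Coins.output, Coins.outputLabels_eq hC]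
  cases indicator P k x i
  · simp
  · simpa using hne

end Correctness

/-! ### The primitives as games -/

section Primitives
variable {P : Params} {T : ℕ → Type} [∀ k, Fintype (T k)] [∀ k, BitRep (T k)]
  [∀ k, FullRep (T k)]

theorem Generator.PseudoRandom.of_coins {G : Generator P} (hG : G.PseudoRandom) (hT : Small T)
    {D : ∀ k, T k × P.Vec k → Bool} (hD : Eff D) :
    Close (fun k => Pr fun ω : T k × Bits (G.seedLen k) => D k (ω.1, G.gen k ω.2))
      fun k => Pr fun ω : T k × P.Vec k => D k ω := by
  have hid := Eff.id ((Small.bits hT).prod hD.small_dom.snd)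
  refine Close.congr (hG (fun k => repLen (T k)) (fun k p => D k (unpack _ p.1, p.2))
    (hD.comp ((Eff.unpack hT hid.fst).pair hid.snd))) (fun k => ?_) fun k => ?_
  all_goals
    exact (Pr_congr_equiv ((unpack (T k)).prodCongr (Equiv.refl _)) fun ω => rfl).symm

theorem HEScheme.CPASecure.indist {HE : HEScheme P} (h : HE.CPASecure) :
    Indist (fun k κ => (HE.keygen k κ).1)
      (fun k (p : Bits (HE.pkLen k) × (P.R k × P.R k) × Bits (HE.encCoins k)) =>
        HE.enc k (p.1, p.2.1.1, p.2.2))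
      (fun k p => HE.enc k (p.1, p.2.1.2, p.2.2)) :=
  h

theorem HEScheme.Homomorphic.indist {HE : HEScheme P} (h : HE.Homomorphic) :
    Indist (fun k (κ : Bits (HE.keyCoins k)) => κ)
      (fun k (p : Bits (HE.keyCoins k) × (P.Classifier k × P.Classifier k × P.R k) ×
          (Fin (P.d k) → Bits (HE.encCoins k)) × Bits (HE.encCoins k)) =>
        HE.add k ((HE.keygen k p.1).1, HE.dot k ((HE.keygen k p.1).1,
          (fun j => HE.enc k ((HE.keygen k p.1).1, p.2.1.1 j, p.2.2.1 j)), p.2.1.2.1),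
          HE.enc k ((HE.keygen k p.1).1, p.2.1.2.2, p.2.2.2)))
      (fun k p => HE.enc k ((HE.keygen k p.1).1,
        (∑ j, p.2.1.1 j * p.2.1.2.1 j) + p.2.1.2.2, p.2.2.2)) := by
  intro r choose guess hc hg
  refine Close.congr (h r choose guess hc hg) (fun k => rfl) fun k => ?_
  refine Eq.trans ?_ (Pr_fst (Ω' := Fin (P.d k) → Bits (HE.encCoins k)) _)
  exact Pr_congr_equiv ⟨fun ω => ((ω.1, ω.2.1, ω.2.2.2), ω.2.2.1),
    fun ω => (ω.1.1, ω.1.2.1, ω.2, ω.1.2.2), fun _ => rfl, fun _ => rfl⟩ fun ω => rfl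

/-- There is nothing public in the game for garbling, hence the empty bit strings. -/
theorem GarbledCircuit.CPASecure.indist {ι κ : ℕ → Type} [∀ k, Fintype (ι k)]
    [∀ k, Fintype (κ k)] {C : ∀ k, Circuit (κ k) (ι k)} {GC : GarbledCircuit C}
    (h : GC.CPASecure) :
    Indist (fun _ (e : Bits 0) => e)
      (fun k (p : Bits 0 × ((ι k → Bool) × (ι k → Bool)) × Bits (GC.coins k)) =>
        ((GC.garble k p.2.2).1, fun i => (GC.garble k p.2.2).2.1 i (p.2.1.1 i)))
      (fun k p => ((GC.garble k p.2.2).1, fun i => (GC.garble k p.2.2).2.1 i (p.2.1.2 i))) := by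
  intro r choose guess hc hg
  have h0 : Small fun _ => Bits 0 := hc.small_dom.snd
  have hid := Eff.id hc.small_dom.fst
  have hid' := Eff.id (hc.small_dom.fst.prod hg.small_dom.snd.snd)
  have hc' := hc.comp (hid.pair (Eff.const hid.small_dom h0 fun _ => default))
  have hg' := hg.comp (hid'.fst.pair ((Eff.const hid'.small_dom h0 fun _ => default).pair
    hid'.snd))
  refine Close.congr (h r _ _ hc' hg') (fun k => ?_) fun k => ?_
  all_goals
    refine Pr_congr_equiv ((Equiv.refl _).prodCongr (Equiv.uniqueProd _ (Bits 0))) fun ω => ?_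
    obtain ⟨ω, e, ρ⟩ := ω
    obtain rfl : e = default := Subsingleton.elim _ _
    rfl

end Primitives

theorem fromPhase_getD {α β : Type} (t p : Fin 6) (a b : α) (f : α → β) :
    fromPhase t p (f ((fromPhase t p a).getD b)) = fromPhase t p (f a) := by
  unfold fromPhase
  split_ifs <;> rfl

theorem fromPhase_of_lt {α : Type} {t p : Fin 6} (h : p < t) (a : α) : fromPhase t p a = none :=
  if_neg (not_le.2 h)

/-! ### Security against a corrupted Cloud -/

section Cloud
variable {P : Params} {G : Generator P} {HE : HEScheme P}
  {C : ∀ k, Circuit (Fin (P.n k)) (P.Wire k)} {GC : GarbledCircuit C}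

variable (G HE GC) in
/-- The views of Cloud in all phases, from the values that it gets. -/
def cloudTable (k : ℕ) (t : Bits (HE.pkLen k) ×
    (P.Classifier k × (Fin (P.n k) → Fin (P.d k) → Bits (HE.ctLen k))) ×
    (Bits (G.seedLen k) × (Fin (P.n k) → Bits (HE.encCoins k))) ×
    (Bits (GC.gcLen k) × (P.Wire k → Bits (GC.labelLen k)))) (p : Fin 6) :
    CloudView G HE GC k :=
  (fromPhase 1 p t.1, fromPhase 2 p t.2.1, fromPhase 3 p t.2.2.1, fromPhase 4 p t.2.2.2)

/-- A world in which the views of Cloud are made from ciphertexts `ct` and labels `l` that depend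
on the input, while CSP outputs the indicator vector. -/
def cloudWorld {k : ℕ} (pk : Bits (HE.pkLen k))
    (ct : P.Input k → Fin (P.n k) → Fin (P.d k) → Bits (HE.ctLen k))
    (s : Bits (G.seedLen k) × (Fin (P.n k) → Bits (HE.encCoins k)))
    (l : P.Input k → Bits (GC.gcLen k) × (P.Wire k → Bits (GC.labelLen k))) :
    World P (CloudView G HE GC k) k where
  view p x := cloudTable G HE GC k (pk, (x.2, ct x), s, l x) p
  out p x := fromPhase 5 p (indicator P k x)

theorem realCloud_eq (hC : ComputesSigns P C) {k : ℕ} (ω : Coins G HE GC k) :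
    realCloud G HE GC k ω = cloudWorld ω.pk ω.encData (ω.seed, ω.noise) fun x =>
      (ω.garbled, fun i => (GC.garble k ω.garbling).2.1 i
        (wireBits P k (fun i => (∑ j, x.1 i j * x.2 j) + ω.noiseVec i) ω.noiseVec i)) := by
  unfold realCloud cloudWorld cloudTable Coins.inputLabels
  congr 1
  · funext p x
    rw [Coins.noisy_eq]
  · funext p x
    rw [Coins.output_eq hC]

variable (G HE GC) in
/-- The coins of the simulator: those of all honest computations, the seed and the coins for
the noise being shown to the adversary. -/
abbrev CloudCoins (k : ℕ) : Type :=
  Bits (HE.keyCoins k) × (Fin (P.n k) → Fin (P.d k) → Bits (HE.encCoins k)) ×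
    (Bits (G.seedLen k) × (Fin (P.n k) → Bits (HE.encCoins k))) × Bits (GC.coins k)

variable (G HE GC) in
/-- The made-up views of Cloud: encryptions of zeros in place of the data, and labels of zeros. -/
def simCloud (k : ℕ) (t : CloudCoins G HE GC k × (Fin 6 × Option (P.Classifier k))) :
    CloudView G HE GC k :=
  (fromPhase 1 t.2.1 (HE.keygen k t.1.1).1,
    fromPhase 2 t.2.1 (t.2.2.getD 0,
      fun i j => HE.enc k ((HE.keygen k t.1.1).1, 0, t.1.2.1 i j)),
    fromPhase 3 t.2.1 t.1.2.2.1,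
    fromPhase 4 t.2.1 ((GC.garble k t.1.2.2.2).1, fun i => (GC.garble k t.1.2.2.2).2.1 i false))

theorem simCloud_eq {k : ℕ} (t : CloudCoins G HE GC k) :
    (⟨fun p x => simCloud G HE GC k (t, (idealCloud P k).view p x), (idealCloud P k).out⟩ :
      World P (CloudView G HE GC k) k) =
    cloudWorld (HE.keygen k t.1).1 (fun _ i j => HE.enc k ((HE.keygen k t.1).1, 0, t.2.1 i j))
      t.2.2.1 fun _ => ((GC.garble k t.2.2.2).1, fun i => (GC.garble k t.2.2.2).2.1 i false) := by
  unfold cloudWorld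
  congr 1
  funext p x
  simp only [simCloud, idealCloud, cloudTable]
  rw [fromPhase_getD 2 p x.2 0 fun w =>
    (w, fun i j => HE.enc k ((HE.keygen k t.1).1, 0, t.2.1 i j))]

theorem small_encCoins (HE : HEScheme P) : Small fun k => Bits (HE.encCoins k) :=
  HE.enc_eff.small_dom.snd.snd

theorem small_cloudCoins : Small (CloudCoins G HE GC) :=
  HE.keygen_eff.small_dom.prod
    ((((small_encCoins HE).pi HE.polyBdd_d).pi G.polyBdd_n).prod
      ((G.gen_eff.small_dom.prod ((small_encCoins HE).pi G.polyBdd_n)).prod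
        GC.garble_eff.small_dom))

/-- Choosing one label for every wire, as efficiently as garbling. -/
theorem GarbledCircuit.select_eff {ι κ α : ℕ → Type} [∀ k, Fintype (ι k)] [∀ k, Fintype (κ k)]
    [∀ k, BitRep (α k)] {C : ∀ k, Circuit (κ k) (ι k)} (GC : GarbledCircuit C)
    {ρ : ∀ k, α k → Bits (GC.coins k)} {x : ∀ k, α k → ι k → Bool} (hρ : Eff ρ) (hx : Eff x) :
    Eff fun k a => ((GC.garble k (ρ k a)).1, fun i => (GC.garble k (ρ k a)).2.1 i (x k a i)) :=
  (GC.garble_eff.comp hρ).fst.pair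
    ((GC.garble_eff.comp hρ).snd.fst.select hx GC.evaluate_eff.small_dom.snd)

theorem small_wireBits (G : Generator P) : Small fun k => P.Wire k → Bool :=
  (wireBits_eff G).small_cod

/-- Encrypting a matrix entry by entry. -/
theorem HEScheme.encMatrix_eff (HE : HEScheme P) (G : Generator P) {α : ℕ → Type}
    [∀ k, BitRep (α k)] {pk : ∀ k, α k → Bits (HE.pkLen k)} {Z : ∀ k, α k → P.Data k}
    {σ : ∀ k, α k → Fin (P.n k) → Fin (P.d k) → Bits (HE.encCoins k)}
    (hpk : Eff pk) (hZ : Eff Z) (hσ : Eff σ) :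
    Eff fun k a i j => HE.enc k (pk k a, Z k a i j, σ k a i j) := by
  have hrow : Eff fun k (p : Bits (HE.pkLen k) × P.Classifier k ×
      (Fin (P.d k) → Bits (HE.encCoins k))) j => HE.enc k (p.1, p.2.1 j, p.2.2 j) := by
    have hid := Eff.id (HE.enc_eff.small_dom.fst.prod
      (HE.dot_eff.small_dom.snd.snd.prod ((small_encCoins HE).pi HE.polyBdd_d)))
    have h := HE.enc_eff.map HE.polyBdd_d ((Eff.piConst HE.polyBdd_d hid.fst).piPair
      (hid.snd.fst.piPair hid.snd.snd))
    exact h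
  have h := hrow.map G.polyBdd_n ((Eff.piConst G.polyBdd_n hpk).piPair (hZ.piPair hσ))
  exact h

theorem simCloud_eff : Eff (simCloud G HE GC) := by
  have hw : Small P.Classifier := HE.dot_eff.small_dom.snd.snd
  have hid := Eff.id ((small_cloudCoins (G := G) (HE := HE) (GC := GC)).prod
    ((Small.fin 6).prod hw.option))
  have hp := hid.snd.fst
  have hpk := (HE.keygen_eff.comp hid.fst.fst).fst
  have hget := hid.snd.snd.getD hw (fun _ => 0) fun k j => by
    change zmodBits (0 : P.R k) j.2 = false
    simp [zmodBits]
  have hct := HE.encMatrix_eff G hpk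
    (Eff.const hid.small_dom (hw.pi G.polyBdd_n) fun k => (0 : P.Data k)) hid.fst.snd.fst
  have hl := GC.select_eff hid.fst.snd.snd.snd
    (Eff.const hid.small_dom (small_wireBits G) fun k _ => false)
  exact (hpk.fromPhase 1 hp).pair (((hget.pair hct).fromPhase 2 hp).pair
    ((hid.fst.snd.snd.fst.fromPhase 3 hp).pair (hl.fromPhase 4 hp)))

variable {auxE auxA envMsg advMsg : ℕ → ℕ} (E : Environment P auxE envMsg advMsg)
  (A : Adversary (CloudView G HE GC) auxA envMsg advMsg)
  (mE : ∀ k, Bits (auxE k)) (mA : ∀ k, Bits (auxA k))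

/-- The input that the environment chooses, which depends on nothing but the public key and the
coins of environment and adversary. -/
def cloudInput (k : ℕ) (t : (Bits (E.coins k) × Bits (A.coins k)) × Bits (HE.pkLen k)) :
    P.Input k :=
  finalInput E A (World.ofTables (fun p => (fromPhase 1 p t.2, none, none, none))
    fun _ => none) (mE k) (mA k) t.1

/-- The verdict of the environment, if Cloud gets the given values. -/
def cloudVerdict (k : ℕ) (t : (Bits (E.coins k) × Bits (A.coins k)) × P.Input k ×
    Bits (HE.pkLen k) × (Fin (P.n k) → Fin (P.d k) → Bits (HE.ctLen k)) ×
    (Bits (G.seedLen k) × (Fin (P.n k) → Bits (HE.encCoins k))) ×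
    (Bits (GC.gcLen k) × (P.Wire k → Bits (GC.labelLen k)))) : Bool :=
  exec E A k (World.ofTables
    (cloudTable G HE GC k (t.2.2.1, (t.2.1.2, t.2.2.2.1), t.2.2.2.2))
    fun p => fromPhase 5 p (indicator P k t.2.1)) (mE k) (mA k) t.1.1 t.1.2

theorem cloudInput_eff : Eff (cloudInput E A mE mA) := by
  have hV : Small (CloudView G HE GC) := A.step_eff.small_dom.snd.fst
  have hout : Small fun k => Option (P.Indicator k) := E.step_eff.small_dom.snd.snd
  have h6 : PolyBdd fun _ => Fintype.card (Fin 6) := .const _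
  have hid := Eff.id ((E.init_eff.small_dom.snd.prod A.init_eff.small_dom.snd).prod
    HE.keygen_eff.small_cod.fst)
  have hrest := Eff.const hid.small_dom (hV.snd.pi h6) fun _ _ => (none, none, none)
  have hnone := Eff.const hid.small_dom (hout.pi h6) fun _ _ => none
  have h := (finalInput_ofTables_eff E A mE mA).comp
    (hid.fst.pair (((hid.snd.fromPhase_table 1).piPair hrest).pair hnone))
  exact h

theorem cloudVerdict_eff (hC : ComputesSigns P C) : Eff (cloudVerdict E A mE mA) := by
  have hid := Eff.id ((E.init_eff.small_dom.snd.prod A.init_eff.small_dom.snd).prod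
    ((E.step_eff.small_cod.snd.snd.fst : Small P.Input).prod
      (HE.keygen_eff.small_cod.fst.prod
      ((((HE.enc_eff.small_cod).pi HE.polyBdd_d).pi G.polyBdd_n).prod
        ((G.gen_eff.small_dom.prod ((small_encCoins HE).pi G.polyBdd_n)).prod
          GC.evaluate_eff.small_dom)))))
  have h := (exec_ofTables_eff E A mE mA).comp (hid.fst.pair
    (((hid.snd.snd.fst.fromPhase_table 1).piPair
      (((hid.snd.fst.snd.pair hid.snd.snd.snd.fst).fromPhase_table 2).piPair
        ((hid.snd.snd.snd.snd.fst.fromPhase_table 3).piPair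
          (hid.snd.snd.snd.snd.snd.fromPhase_table 4)))).pair
      (((indicator_eff HE G GC hC).comp hid.snd.fst).fromPhase_table 5)))
  exact h

theorem exec_cloudWorld {k : ℕ} (ρ : Bits (E.coins k) × Bits (A.coins k))
    (pk : Bits (HE.pkLen k)) (ct : P.Input k → Fin (P.n k) → Fin (P.d k) → Bits (HE.ctLen k))
    (s : Bits (G.seedLen k) × (Fin (P.n k) → Bits (HE.encCoins k)))
    (l : P.Input k → Bits (GC.gcLen k) × (P.Wire k → Bits (GC.labelLen k))) :
    exec E A k (cloudWorld pk ct s l) (mE k) (mA k) ρ.1 ρ.2 =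
      cloudVerdict E A mE mA k (ρ, cloudInput E A mE mA k (ρ, pk), pk,
        ct (cloudInput E A mE mA k (ρ, pk)), s, l (cloudInput E A mE mA k (ρ, pk))) := by
  refine exec_eq_ofTables (fun p hp x => ?_) (fun p hp x => ?_) _ _ _ rfl
  · have h3 : p < 3 := hp.trans (by decide)
    have h4 : p < 4 := hp.trans (by decide)
    simp only [cloudWorld, cloudTable, fromPhase_of_lt hp, fromPhase_of_lt h3,
      fromPhase_of_lt h4]
  · exact fromPhase_of_lt (hp.trans (by decide)) _

/-- The encrypted data, for given coins. -/
def cloudData {k : ℕ} (c : CloudCoins G HE GC k) (x : P.Input k) :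
    Fin (P.n k) → Fin (P.d k) → Bits (HE.ctLen k) :=
  fun i j => HE.enc k ((HE.keygen k c.1).1, x.1 i j, c.2.1 i j)

/-- The garbled circuit with the labels for a given input of the circuit. -/
def cloudLabels {k : ℕ} (c : CloudCoins G HE GC k) (b : P.Wire k → Bool) :
    Bits (GC.gcLen k) × (P.Wire k → Bits (GC.labelLen k)) :=
  ((GC.garble k c.2.2.2).1, fun i => (GC.garble k c.2.2.2).2.1 i (b i))

/-- The input of the circuit for sign checking. -/
def cloudBits {k : ℕ} (c : CloudCoins G HE GC k) (x : P.Input k) : P.Wire k → Bool :=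
  wireBits P k (fun i => (∑ j, x.1 i j * x.2 j) + G.gen k c.2.2.1.1 i) (G.gen k c.2.2.1.1)

/-- The probability of verdict `1` in worlds for a corrupted Cloud. -/
noncomputable def cloudProb (W : ∀ k, CloudCoins G HE GC k → World P (CloudView G HE GC k) k)
    (k : ℕ) : ℝ :=
  Pr fun ω : (Bits (E.coins k) × Bits (A.coins k)) × CloudCoins G HE GC k =>
    exec E A k (W k ω.2) (mE k) (mA k) ω.1.1 ω.1.2

/-- By the security of the garbling, the labels may be replaced by those of zeros. -/
theorem cloud_garbling_step (hC : ComputesSigns P C) (hGC : GC.CPASecure) :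
    Close
      (cloudProb E A mE mA fun k c => cloudWorld (HE.keygen k c.1).1 (cloudData c) c.2.2.1
        fun x => cloudLabels c (cloudBits c x))
      (cloudProb E A mE mA fun k c => cloudWorld (HE.keygen k c.1).1 (cloudData c) c.2.2.1
        fun _ => cloudLabels c fun _ => false) := by
  have hin := cloudInput_eff E A mE mA
  have hver := cloudVerdict_eff E A mE mA hC
  have hT : Small fun k => (Bits (E.coins k) × Bits (A.coins k)) × Bits (HE.keyCoins k) ×
      (Fin (P.n k) → Fin (P.d k) → Bits (HE.encCoins k)) ×
        (Bits (G.seedLen k) × (Fin (P.n k) → Bits (HE.encCoins k))) :=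
    (E.init_eff.small_dom.snd.prod A.init_eff.small_dom.snd).prod
      (HE.keygen_eff.small_dom.prod
        ((((small_encCoins HE).pi HE.polyBdd_d).pi G.polyBdd_n).prod
          (G.gen_eff.small_dom.prod ((small_encCoins HE).pi G.polyBdd_n))))
  have h0 : Small fun _ => Bits 0 := Small.bits (.const 0)
  have hid := Eff.id (hT.prod h0)
  have hx := hin.comp (hid.fst.fst.pair (HE.keygen_eff.comp hid.fst.snd.fst).fst)
  have hnoise := G.gen_eff.comp hid.fst.snd.snd.snd.fst
  have hchoose := ((wireBits_eff G).comp
    (((HE.noisyPrediction_eff G).comp (hx.pair hnoise)).pair hnoise)).pair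
      (Eff.const hid.small_dom (small_wireBits G) fun _ _ => false)
  have hid' := Eff.id (hT.prod (h0.prod GC.evaluate_eff.small_dom))
  have hpk' := (HE.keygen_eff.comp hid'.fst.snd.fst).fst
  have hx' := hin.comp (hid'.fst.fst.pair hpk')
  have hguess := hver.comp (hid'.fst.fst.pair (hx'.pair (hpk'.pair
    ((HE.encMatrix_eff G hpk' hx'.fst hid'.fst.snd.snd.fst).pair
      (hid'.fst.snd.snd.snd.pair hid'.snd.snd)))))
  refine (hGC.indist.of_coins hT hchoose hguess).congr (fun k => ?_) fun k => ?_
  all_goals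
    refine Pr_congr_equiv ⟨fun ω => ((ω.1, ω.2.1, ω.2.2.1, ω.2.2.2.1), fun i => i.elim0,
      ω.2.2.2.2), fun ω => (ω.1.1, ω.1.2.1, ω.1.2.2.1, ω.1.2.2.2, ω.2.2), fun _ => rfl,
      fun ω => Prod.ext rfl (Prod.ext (Subsingleton.elim _ _) rfl)⟩ fun ω => ?_
    exact exec_cloudWorld E A mE mA ω.1 _ _ _ _

/-- By the security of the encryption, the data may be replaced by zeros once the labels do not
depend on the data and the secret key any more. -/
theorem cloud_encryption_step (hC : ComputesSigns P C) (hHE : HE.CPASecure) :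
    Close
      (cloudProb E A mE mA fun k c => cloudWorld (HE.keygen k c.1).1 (cloudData c) c.2.2.1
        fun _ => cloudLabels c fun _ => false)
      (cloudProb E A mE mA fun k c => cloudWorld (HE.keygen k c.1).1
        (fun _ => cloudData c 0) c.2.2.1 fun _ => cloudLabels c fun _ => false) := by
  have hin := cloudInput_eff E A mE mA
  have hver := cloudVerdict_eff E A mE mA hC
  have hT : Small fun k => (Bits (E.coins k) × Bits (A.coins k)) ×
      (Bits (G.seedLen k) × (Fin (P.n k) → Bits (HE.encCoins k))) × Bits (GC.coins k) :=
    (E.init_eff.small_dom.snd.prod A.init_eff.small_dom.snd).prod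
      ((G.gen_eff.small_dom.prod ((small_encCoins HE).pi G.polyBdd_n)).prod
        GC.garble_eff.small_dom)
  have hJ : PolyBdd fun k => Fintype.card (Fin (P.n k) × Fin (P.d k)) :=
    (G.polyBdd_n.mul HE.polyBdd_d).mono fun k => (Fintype.card_prod _ _).le
  have hR := HE.enc_eff.small_dom.snd.fst
  have hid := Eff.id (hT.prod HE.keygen_eff.small_cod.fst)
  have hchoose := (hin.comp (hid.fst.fst.pair hid.snd)).fst.uncurry.piPair
    (Eff.const hid.small_dom (hR.pi hJ) fun k _ => (0 : P.R k))
  have hid' := Eff.id (hT.prod (HE.keygen_eff.small_cod.fst.prod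
    (HE.enc_eff.small_cod.pi hJ)))
  have hguess := hver.comp (hid'.fst.fst.pair ((hin.comp (hid'.fst.fst.pair
    hid'.snd.fst)).pair (hid'.snd.fst.pair (hid'.snd.snd.curry.pair
      (hid'.fst.snd.fst.pair (GC.select_eff hid'.fst.snd.snd
        (Eff.const hid'.small_dom (small_wireBits G) fun _ _ => false)))))))
  have hid_enc := Eff.id (HE.enc_eff.small_dom.fst.prod ((hR.prod hR).prod (small_encCoins HE)))
  refine (hHE.indist.pi hT hJ (hR.prod hR)
    (HE.enc_eff.comp (hid_enc.fst.pair (hid_enc.snd.fst.fst.pair hid_enc.snd.snd)))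
    (HE.enc_eff.comp (hid_enc.fst.pair (hid_enc.snd.fst.snd.pair hid_enc.snd.snd)))
    hchoose hguess).congr (fun k => ?_) fun k => ?_
  all_goals
    refine Pr_congr_equiv ⟨fun ω => (((ω.1, ω.2.2.2.1, ω.2.2.2.2), ω.2.1),
      fun j => ω.2.2.1 j.1 j.2), fun ω => (ω.1.1.1, ω.1.2, fun i j => ω.2 (i, j),
        ω.1.1.2.1, ω.1.1.2.2), fun _ => rfl, fun _ => rfl⟩ fun ω => ?_
    exact exec_cloudWorld E A mE mA ω.1 _ _ _ _

end Cloud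

theorem realCloud_realizes {P : Params} {G : Generator P} {HE : HEScheme P}
    {C : ∀ k, Circuit (Fin (P.n k)) (P.Wire k)} {GC : GarbledCircuit C}
    (hC : ComputesSigns P C) (hHE : HE.CPASecure) (hGC : GC.CPASecure) :
    UCRealizes P (realCloud G HE GC) (idealCloud P) := by
  intro auxA envMsg advMsg A
  refine ⟨simulator A small_cloudCoins (simCloud G HE GC) simCloud_eff, fun auxE E mE mA => ?_⟩
  refine ((cloud_garbling_step E A mE mA hC hGC).trans
    (cloud_encryption_step E A mE mA hC hHE)).congr (fun k => ?_) fun k => ?_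
  · refine Pr_congr_equiv ⟨fun ω => ((ω.1, ω.2.1), ω.2.2.key, ω.2.2.data,
      (ω.2.2.seed, ω.2.2.noise), ω.2.2.garbling), fun ω => (ω.1.1, ω.1.2,
        ⟨ω.2.1, ω.2.2.1, ω.2.2.2.1.1, ω.2.2.2.1.2, ω.2.2.2.2⟩), fun _ => rfl,
        fun _ => rfl⟩ fun ω => ?_
    rw [realCloud_eq hC]
    rfl
  · refine (Pr_congr_equiv ((Equiv.prodAssoc _ _ _).trans
      ((Equiv.refl _).prodCongr (unpack _).symm)) fun ω => ?_).symm
    refine Eq.trans ?_ (exec_simulator E A _ _ _ _ _ _ _ _ _).symm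
    rw [simCloud_eq]
    rfl

/-! ### Security against a corrupted CSP -/

section CSP
variable {P : Params} {G : Generator P} {HE : HEScheme P}
  {C : ∀ k, Circuit (Fin (P.n k)) (P.Wire k)} {GC : GarbledCircuit C}

variable (HE GC) in
/-- The views of CSP in all phases, from its coins, the ciphertexts that it gets, and the
indicator vector. -/
def cspTable (k : ℕ) (t : Bits (HE.keyCoins k) × (Fin (P.n k) → Bits (HE.ctLen k)) ×
    Bits (GC.coins k) × P.Indicator k) (p : Fin 6) : CSPView HE GC k :=
  (fromPhase 1 p t.1, fromPhase 3 p t.2.1, fromPhase 4 p t.2.2.1,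
    fromPhase 5 p fun i => (GC.garble k t.2.2.1).2.2 i (!t.2.2.2 i))

/-- A world in which the views of CSP are made from ciphertexts `ct` that depend on the input. -/
def cspWorld {k : ℕ} (key : Bits (HE.keyCoins k))
    (ct : P.Input k → Fin (P.n k) → Bits (HE.ctLen k)) (g : Bits (GC.coins k)) :
    World P (CSPView HE GC k) k where
  view p x := cspTable HE GC k (key, ct x, g, indicator P k x) p
  out p x := fromPhase 5 p (indicator P k x)

theorem realCSP_eq (hC : ComputesSigns P C) {k : ℕ} (ω : Coins G HE GC k) :
    realCSP G HE GC k ω = cspWorld ω.key ω.encNoisy ω.garbling := by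
  unfold realCSP cspWorld cspTable
  congr 1
  · funext p x
    rw [Coins.outputLabels_eq hC]
  · funext p x
    rw [Coins.output_eq hC]

variable (G HE GC) in
/-- The coins of the simulator: for the keys, the encryption and the garbling, and a seed. -/
abbrev CSPCoins (k : ℕ) : Type :=
  (Bits (HE.keyCoins k) × (Fin (P.n k) → Bits (HE.encCoins k)) × Bits (GC.coins k)) ×
    Bits (G.seedLen k)

/-- Fresh encryptions of the entries of a vector. -/
def encVec {k : ℕ} (key : Bits (HE.keyCoins k)) (σ : Fin (P.n k) → Bits (HE.encCoins k))
    (v : P.Vec k) : Fin (P.n k) → Bits (HE.ctLen k) :=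
  fun i => HE.enc k ((HE.keygen k key).1, v i, σ i)

variable (G HE GC) in
/-- The made-up views of CSP: encryptions of the noise alone, and the labels of the output. -/
def simCSP (k : ℕ) (t : CSPCoins G HE GC k × (Fin 6 × Option (P.Indicator k))) :
    CSPView HE GC k :=
  (fromPhase 1 t.2.1 t.1.1.1,
    fromPhase 3 t.2.1 (encVec t.1.1.1 t.1.1.2.1 (G.gen k t.1.2)),
    fromPhase 4 t.2.1 t.1.1.2.2,
    fromPhase 5 t.2.1 fun i =>
      (GC.garble k t.1.1.2.2).2.2 i (!t.2.2.getD (fun _ => false) i))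

theorem simCSP_eq {k : ℕ} (t : CSPCoins G HE GC k) :
    (⟨fun p x => simCSP G HE GC k (t, (idealCSP P k).view p x), (idealCSP P k).out⟩ :
      World P (CSPView HE GC k) k) =
    cspWorld t.1.1 (fun _ => encVec t.1.1 t.1.2.1 (G.gen k t.2)) t.1.2.2 := by
  unfold cspWorld
  congr 1
  funext p x
  simp only [simCSP, idealCSP, cspTable]
  rw [fromPhase_getD 5 p (indicator P k x) (fun _ => false) fun I i =>
    (GC.garble k t.1.2.2).2.2 i (!I i)]

theorem small_cspCoins : Small (CSPCoins G HE GC) :=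
  (HE.keygen_eff.small_dom.prod (((small_encCoins HE).pi G.polyBdd_n).prod
    GC.garble_eff.small_dom)).prod G.gen_eff.small_dom

theorem encVec_eff (G : Generator P) {α : ℕ → Type} [∀ k, BitRep (α k)]
    {key : ∀ k, α k → Bits (HE.keyCoins k)}
    {σ : ∀ k, α k → Fin (P.n k) → Bits (HE.encCoins k)} {v : ∀ k, α k → P.Vec k}
    (hkey : Eff key) (hσ : Eff σ) (hv : Eff v) :
    Eff fun k a => encVec (key k a) (σ k a) (v k a) := by
  have h := HE.enc_eff.map G.polyBdd_n
    ((Eff.piConst G.polyBdd_n (HE.keygen_eff.comp hkey).fst).piPair (hv.piPair hσ))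
  exact h

theorem simCSP_eff : Eff (simCSP G HE GC) := by
  have hI : Small P.Indicator := Small.bool.pi G.polyBdd_n
  have hid := Eff.id ((small_cspCoins (G := G) (HE := HE) (GC := GC)).prod
    ((Small.fin 6).prod hI.option))
  have hp := hid.snd.fst
  have hget := hid.snd.snd.getD hI (fun _ _ => false) fun _ _ => rfl
  have hct := encVec_eff G hid.fst.fst.fst hid.fst.fst.snd.fst (G.gen_eff.comp hid.fst.snd)
  have hl := (GC.labels_eff G).comp (hid.fst.fst.snd.snd.pair hget)
  exact (hid.fst.fst.fst.fromPhase 1 hp).pair ((hct.fromPhase 3 hp).pair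
    ((hid.fst.fst.snd.snd.fromPhase 4 hp).pair (hl.fromPhase 5 hp)))

variable {auxE auxA envMsg advMsg : ℕ → ℕ} (E : Environment P auxE envMsg advMsg)
  (A : Adversary (CSPView HE GC) auxA envMsg advMsg)
  (mE : ∀ k, Bits (auxE k)) (mA : ∀ k, Bits (auxA k))

/-- The input that the environment chooses, which depends on nothing but the coins for the keys
and those of environment and adversary. -/
def cspInput (k : ℕ) (t : (Bits (E.coins k) × Bits (A.coins k)) × Bits (HE.keyCoins k)) :
    P.Input k :=
  finalInput E A (World.ofTables (fun p => (fromPhase 1 p t.2, none, none, none))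
    fun _ => none) (mE k) (mA k) t.1

/-- The verdict of the environment, if CSP gets the given values. -/
def cspVerdict (k : ℕ) (t : (Bits (E.coins k) × Bits (A.coins k)) × P.Input k ×
    Bits (HE.keyCoins k) × (Fin (P.n k) → Bits (HE.ctLen k)) × Bits (GC.coins k)) : Bool :=
  exec E A k (World.ofTables
    (cspTable HE GC k (t.2.2.1, t.2.2.2.1, t.2.2.2.2, indicator P k t.2.1))
    fun p => fromPhase 5 p (indicator P k t.2.1)) (mE k) (mA k) t.1.1 t.1.2

theorem cspInput_eff : Eff (cspInput E A mE mA) := by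
  have hV : Small (CSPView HE GC) := A.step_eff.small_dom.snd.fst
  have hout : Small fun k => Option (P.Indicator k) := E.step_eff.small_dom.snd.snd
  have h6 : PolyBdd fun _ => Fintype.card (Fin 6) := .const _
  have hid := Eff.id ((E.init_eff.small_dom.snd.prod A.init_eff.small_dom.snd).prod
    HE.keygen_eff.small_dom)
  have hrest := Eff.const hid.small_dom (hV.snd.pi h6) fun _ _ => (none, none, none)
  have hnone := Eff.const hid.small_dom (hout.pi h6) fun _ _ => none
  have h := (finalInput_ofTables_eff E A mE mA).comp
    (hid.fst.pair (((hid.snd.fromPhase_table 1).piPair hrest).pair hnone))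
  exact h

theorem cspVerdict_eff (G : Generator P) (hC : ComputesSigns P C) :
    Eff (cspVerdict E A mE mA) := by
  have hid := Eff.id ((E.init_eff.small_dom.snd.prod A.init_eff.small_dom.snd).prod
    ((E.step_eff.small_cod.snd.snd.fst : Small P.Input).prod
      (HE.keygen_eff.small_dom.prod
        ((HE.enc_eff.small_cod.pi G.polyBdd_n).prod GC.garble_eff.small_dom))))
  have hI := (indicator_eff HE G GC hC).comp hid.snd.fst
  have hl := (GC.labels_eff G).comp (hid.snd.snd.snd.snd.pair hI)
  have h := (exec_ofTables_eff E A mE mA).comp (hid.fst.pair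
    (((hid.snd.snd.fst.fromPhase_table 1).piPair
      ((hid.snd.snd.snd.fst.fromPhase_table 3).piPair
        ((hid.snd.snd.snd.snd.fromPhase_table 4).piPair (hl.fromPhase_table 5)))).pair
      (hI.fromPhase_table 5)))
  exact h

theorem exec_cspWorld {k : ℕ} (ρ : Bits (E.coins k) × Bits (A.coins k))
    (key : Bits (HE.keyCoins k)) (ct : P.Input k → Fin (P.n k) → Bits (HE.ctLen k))
    (g : Bits (GC.coins k)) :
    exec E A k (cspWorld key ct g) (mE k) (mA k) ρ.1 ρ.2 =
      cspVerdict E A mE mA k (ρ, cspInput E A mE mA k (ρ, key), key,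
        ct (cspInput E A mE mA k (ρ, key)), g) := by
  refine exec_eq_ofTables (fun p hp x => ?_) (fun p hp x => ?_) _ _ _ rfl
  · have h3 : p < 3 := hp.trans (by decide)
    have h4 : p < 4 := hp.trans (by decide)
    have h5 : p < 5 := hp.trans (by decide)
    simp only [cspWorld, cspTable, fromPhase_of_lt h3, fromPhase_of_lt h4, fromPhase_of_lt h5]
  · exact fromPhase_of_lt (hp.trans (by decide)) _

/-- The vector of predictions `Z w`. -/
def predictions {k : ℕ} (x : P.Input k) : P.Vec k := fun i => ∑ j, x.1 i j * x.2 j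

/-- The probability of verdict `1` in worlds for a corrupted CSP, with noise from a
distribution that is given by coins in `N`. -/
noncomputable def cspProb {N : ℕ → Type} [∀ k, Fintype (N k)]
    (ct : ∀ k, Bits (HE.keyCoins k) → (Fin (P.n k) → Bits (HE.encCoins k)) → N k → P.Input k →
      Fin (P.n k) → Bits (HE.ctLen k)) (k : ℕ) : ℝ :=
  Pr fun ω : ((Bits (E.coins k) × Bits (A.coins k)) × Bits (HE.keyCoins k) ×
      (Fin (P.n k) → Bits (HE.encCoins k)) × Bits (GC.coins k)) × N k =>
    exec E A k (cspWorld ω.1.2.1 (ct k ω.1.2.1 ω.1.2.2.1 ω.2) ω.1.2.2.2) (mE k) (mA k)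
      ω.1.1.1 ω.1.1.2

/-- By the homomorphic identity, the noisy ciphertexts may be replaced by fresh encryptions of
the noisy predictions. -/
theorem csp_homomorphic_step (hC : ComputesSigns P C) (hHom : HE.Homomorphic) :
    Close
      (fun k => Pr fun ω : Bits (E.coins k) × Bits (A.coins k) × Coins G HE GC k =>
        exec E A k (cspWorld ω.2.2.key ω.2.2.encNoisy ω.2.2.garbling) (mE k) (mA k) ω.1 ω.2.1)
      (cspProb E A mE mA fun k key σ s x => encVec key σ (predictions x + G.gen k s)) := by
  have hin := cspInput_eff E A mE mA
  have hver := cspVerdict_eff E A mE mA G hC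
  have hw : Small P.Classifier := HE.dot_eff.small_dom.snd.snd
  have hR : Small P.R := HE.enc_eff.small_dom.snd.fst
  have hM := hw.prod (hw.prod hR)
  have hT : Small fun k => (Bits (E.coins k) × Bits (A.coins k)) × Bits (GC.coins k) ×
      Bits (G.seedLen k) :=
    (E.init_eff.small_dom.snd.prod A.init_eff.small_dom.snd).prod
      (GC.garble_eff.small_dom.prod G.gen_eff.small_dom)
  have hid := Eff.id (hT.prod HE.keygen_eff.small_dom)
  have hx := hin.comp (hid.fst.fst.pair hid.snd)
  have hchoose := hx.fst.piPair ((Eff.piConst G.polyBdd_n hx.snd).piPair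
    (G.gen_eff.comp hid.fst.snd.snd))
  have hid' := Eff.id (hT.prod (HE.keygen_eff.small_dom.prod
    (HE.enc_eff.small_cod.pi G.polyBdd_n)))
  have hguess := hver.comp (hid'.fst.fst.pair ((hin.comp (hid'.fst.fst.pair
    hid'.snd.fst)).pair (hid'.snd.fst.pair (hid'.snd.snd.pair hid'.fst.snd.fst))))
  have hid_s := Eff.id (HE.keygen_eff.small_dom.prod (hM.prod
    (((small_encCoins HE).pi HE.polyBdd_d).prod (small_encCoins HE))))
  have hpk := (HE.keygen_eff.comp hid_s.fst).fst
  have hrow := HE.enc_eff.map HE.polyBdd_d ((Eff.piConst HE.polyBdd_d hpk).piPair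
    (hid_s.snd.fst.fst.piPair hid_s.snd.snd.fst))
  have hs := HE.add_eff.comp (hpk.pair ((HE.dot_eff.comp (hpk.pair
    (hrow.pair hid_s.snd.fst.snd.fst))).pair (HE.enc_eff.comp (hpk.pair
      (hid_s.snd.fst.snd.snd.pair hid_s.snd.snd.snd)))))
  have hs' := HE.enc_eff.comp (hpk.pair ((HE.dotProduct_add_eff.comp hid_s.snd.fst).pair
    hid_s.snd.snd.snd))
  refine (hHom.indist.pi hT G.polyBdd_n hM hs hs' hchoose hguess).congr (fun k => ?_) fun k => ?_
  · refine Pr_congr_equiv ⟨fun ω => ((((ω.1, ω.2.1), ω.2.2.garbling, ω.2.2.seed), ω.2.2.key),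
      fun i => (ω.2.2.data i, ω.2.2.noise i)), fun ω => (ω.1.1.1.1, ω.1.1.1.2,
        ⟨ω.1.2, fun i => (ω.2 i).1, ω.1.1.2.2, fun i => (ω.2 i).2, ω.1.1.2.1⟩), fun _ => rfl,
        fun _ => rfl⟩ fun ω => ?_
    exact exec_cspWorld E A mE mA (ω.1, ω.2.1) _ _ _
  · -- the coins for the encryption of the data are not used any more
    refine (Pr_fst (Ω' := Fin (P.n k) → Fin (P.d k) → Bits (HE.encCoins k)) _).symm.trans ?_
    refine Pr_congr_equiv ⟨fun ω => (((ω.1.1.1, ω.1.1.2.2.2, ω.1.2), ω.1.1.2.1),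
      fun i => (ω.2 i, ω.1.1.2.2.1 i)), fun ω => (((ω.1.1.1, ω.1.2, fun i => (ω.2 i).2,
        ω.1.1.2.1), ω.1.1.2.2), fun i => (ω.2 i).1), fun _ => rfl, fun _ => rfl⟩ fun ω => ?_
    exact exec_cspWorld E A mE mA ω.1.1.1 _ _ _

/-- By pseudo-randomness, the output of the generator may be replaced by uniform noise, for any
efficient way `u` of combining the input and the noise. -/
theorem csp_generator_step (hC : ComputesSigns P C) (hG : G.PseudoRandom)
    {u : ∀ k, P.Input k × P.Vec k → P.Vec k} (hu : Eff u) :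
    Close (cspProb E A mE mA fun k key σ s x => encVec key σ (u k (x, G.gen k s)))
      (cspProb E A mE mA fun k key σ v x => encVec key σ (u k (x, v))) := by
  have hT : Small fun k => (Bits (E.coins k) × Bits (A.coins k)) × Bits (HE.keyCoins k) ×
      (Fin (P.n k) → Bits (HE.encCoins k)) × Bits (GC.coins k) :=
    (E.init_eff.small_dom.snd.prod A.init_eff.small_dom.snd).prod
      (HE.keygen_eff.small_dom.prod (((small_encCoins HE).pi G.polyBdd_n).prod
        GC.garble_eff.small_dom))
  have hid := Eff.id (hT.prod G.gen_eff.small_cod)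
  have hx := (cspInput_eff E A mE mA).comp (hid.fst.fst.pair hid.fst.snd.fst)
  have hD := (cspVerdict_eff E A mE mA G hC).comp (hid.fst.fst.pair (hx.pair
    (hid.fst.snd.fst.pair ((encVec_eff G hid.fst.snd.fst hid.fst.snd.snd.fst
      (hu.comp (hx.pair hid.snd))).pair hid.fst.snd.snd.snd))))
  refine (hG.of_coins hT hD).congr (fun k => ?_) fun k => ?_
  all_goals exact congrArg Pr (funext fun ω => exec_cspWorld E A mE mA ω.1.1 _ _ _)

/-- Uniform noise hides the predictions, because the input has been fixed before the noise is
used: a translation of the noise gives a bijection between the coins of both sides. -/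
theorem csp_masking_step (k : ℕ) :
    cspProb E A mE mA (fun k key σ (v : P.Vec k) x => encVec key σ (predictions x + v)) k =
      cspProb E A mE mA (fun k key σ (v : P.Vec k) _ => encVec key σ v) k := by
  let f : (Bits (E.coins k) × Bits (A.coins k)) × Bits (HE.keyCoins k) ×
      (Fin (P.n k) → Bits (HE.encCoins k)) × Bits (GC.coins k) → P.Vec k :=
    fun ω => predictions (cspInput E A mE mA k (ω.1, ω.2.1))
  refine Pr_congr_equiv ⟨fun ω => (ω.1, f ω.1 + ω.2), fun ω => (ω.1, -f ω.1 + ω.2),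
    fun ω => by simp, fun ω => by simp⟩ fun ω => ?_
  exact (exec_cspWorld E A mE mA ω.1.1 _ _ _).trans
    (exec_cspWorld E A mE mA ω.1.1 ω.1.2.1 (fun _ => encVec ω.1.2.1 ω.1.2.2.1 (f ω.1 + ω.2))
      ω.1.2.2.2).symm

end CSP

theorem realCSP_realizes {P : Params} {G : Generator P} {HE : HEScheme P}
    {C : ∀ k, Circuit (Fin (P.n k)) (P.Wire k)} {GC : GarbledCircuit C}
    (hC : ComputesSigns P C) (hG : G.PseudoRandom) (hHom : HE.Homomorphic) :
    UCRealizes P (realCSP G HE GC) (idealCSP P) := by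
  intro auxA envMsg advMsg A
  refine ⟨simulator A small_cspCoins (simCSP G HE GC) simCSP_eff, fun auxE E mE mA => ?_⟩
  have hid := Eff.id ((E.step_eff.small_cod.snd.snd.fst : Small P.Input).prod
    G.gen_eff.small_cod)
  have hu : Eff fun k (p : P.Input k × P.Vec k) => predictions p.1 + p.2 :=
    HE.noisyPrediction_eff G
  refine ((csp_homomorphic_step E A mE mA hC hHom).trans
    ((csp_generator_step E A mE mA hC hG hu).trans
      ((Close.of_eq (csp_masking_step E A mE mA)).trans
        (csp_generator_step E A mE mA hC hG hid.snd).symm))).congr (fun k => ?_) fun k => ?_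
  · refine congrArg Pr (funext fun ω => ?_)
    rw [realCSP_eq hC]
  · refine (Pr_congr_equiv ⟨fun ω => (ω.1.1.1, (unpack _).symm (ω.1.1.2, ω.1.2, ω.2)), fun ω =>
      let c := unpack (Bits (A.coins k) × CSPCoins G HE GC k) ω.2
      (((ω.1, c.1), c.2.1), c.2.2), fun ω => ?_, fun ω => ?_⟩ fun ω => ?_).symm
    · simp
    · simp
    · refine Eq.trans ?_ (exec_simulator E A _ _ _ _ _ _ _ _ _).symm
      rw [simCSP_eq]
      rfl

end SecureBoost

theorem theorem1 (P : SecureBoost.Params)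
    (G : SecureBoost.Generator P)
    (HE : SecureBoost.HEScheme P)
    (C : ∀ k, SecureBoost.Circuit (Fin (P.n k)) (P.Wire k))
    (GC : SecureBoost.GarbledCircuit C)
    (hC : SecureBoost.ComputesSigns P C)
    (hG : G.PseudoRandom)
    (hHom : HE.Homomorphic)
    (hHE : HE.CPASecure)
    (hGC : GC.CPASecure) :
    SecureBoost.UCRealizes P (SecureBoost.realCloud G HE GC) (SecureBoost.idealCloud P) ∧
    SecureBoost.UCRealizes P (SecureBoost.realCSP G HE GC) (SecureBoost.idealCSP P) :=
  ⟨SecureBoost.realCloud_realizes hC hHE hGC, SecureBoost.realCSP_realizes hC hG hHom⟩
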